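/- \textbf{Model.} There are $n$ candidates; candidate $i\in[n]$ has utility $\rho_i\ge 0$ for a receiver $\mathcal R$ and utility $\xi_i\ge 0$ for a sender $\mathcal S$. The $\rho_i$ are pairwise distinct and the $\xi_i$ are pairwise distinct; let $c_{\mathcal S}=\arg\max_i \xi_i$. The candidates arrive in rounds $1,\dots,n$ in uniformly random order. $\mathcal R$ knows all the pairs $(\rho_i,\xi_i)$, but not the order of arrival. In each round $t$ the sender observes the pair $\theta_t=(\rho,\xi)$ of the arriving candidate and sends a signal $\sigma_t\in\{\mathrm{HIRE},\mathrm{NOT}\}$; then $\mathcal R$, who sees only the signals $\sigma_1,\dots,\sigma_t$ (no disclosure), irrevocably hires or rejects the current candidate, and hiring ends the process. $\mathcal S$ commits in advance to a (direct, randomized) strategy, which gives for every $t$ the probability of $\sigma_t=\mathrm{HIRE}$ as a function of $\theta_1,\dots,\theta_t$ and $\sigma_1,\dots,\sigma_{t-1}$. In the \emph{basic} scenario the strategy may be chosen with knowledge of all the pairs $(\rho_i,\xi_i)$; in the \emph{secretary} scenario the same strategy is used for all instances with $n$ candidates. The utility of $\mathcal R$ is $\rho_i$ if candidate $i$ is hired,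 and $0$ if nobody is hired. A strategy is \emph{persuasive} for an instance if in every round $t$ that is reached by an obedient receiver (one who hires exactly upon the signal HIRE) and for all signals $\sigma_1,\dots,\sigma_t$ that she may have received, her conditional expected utility from obedience is at least that from any other way of playing in rounds $t,\dots,n$ based on the signals. The \emph{success probability} of a strategy is the probability that an obedient receiver hires $c_{\mathcal S}$. The \emph{benchmark} $\mathrm{OPT}$ of an instance is the supremum of the success probabilities of all persuasive strategies in the basic scenario. \textbf{Pareto procedure} (ordinal sender utility). The input is a finite nonempty set $A$ of valuation pairs. Scale the receiver values such that their maximum over $A$ is $1$, and replace the sender value of the best candidate $c\in A$ for the sender by $1$ and all other sender values by $0$. Let $\mu$ be the average receiver value in $A$. If $\rho_{c}\ge\mu$, set $a=b=c$; otherwise let $a,b\in A$ be the ends of a segment of the Pareto frontier (the set of non-dominated points) of the convex hull of the points $(\rho_i,\xi_i)$, $i\in A$, that meets the line $\rho=\mu$. Let $\alpha=1$ if $\rho_a=\rho_b$, let $\alpha=0$ if $\rho_a\neq\rho_b$ and $\xi_a=\xi_b$, and $\alpha=\frac{\mu-\rho_b}{\rho_a-\rho_b}$ otherwise. Return $a$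 with probability $\alpha$ and $b$ otherwise. \textbf{Growing Pareto mechanism} with sample size $s$. As long as no HIRE has been signaled: in each round $t\le n-1$ signal NOT if $t\le s$; if $t>s$, apply the Pareto procedure (with fresh randomness) to the set of the $t$ candidates that have arrived so far, and signal HIRE if it returns the candidate of round $t$, and NOT otherwise; in round $n$ signal HIRE. After a HIRE signal, all later signals are NOT. \textbf{Theorem.} For every $n$ and every instance with $n$ candidates, the Growing Pareto mechanism with $s=\lfloor n/2\rfloor$ is persuasive. Moreover, there is a sequence $\varepsilon_n\to 0$ such that for every $n$ and every instance with $n$ candidates its success probability is at least $\left(\frac14-\varepsilon_n\right)\mathrm{OPT}$. -/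

import Mathlib

namespace OnlinePersuasion

/-! ## Instances, signaling strategies and decision rules -/

/-- `n` candidates; candidate `i` has utility `rv i` for the receiver and `sv i` for the sender.
Utilities are non-negative, and no two candidates are equally good for the same player. -/
structure Instance (n : ℕ) where
  rv : Fin n → ℝ
  sv : Fin n → ℝ
  rv_nonneg : ∀ i, 0 ≤ rv i
  sv_nonneg : ∀ i, 0 ≤ sv i
  rv_injective : Function.Injective rv
  sv_injective : Function.Injective sv

/-- The valuation pairs (receiver value, sender value) revealed to the sender in rounds
`0, …, n - 1` when candidate `π t` arrives in round `t`. -/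
def Instance.states {n : ℕ} (I : Instance n) (π : Equiv.Perm (Fin n)) : Fin n → ℝ × ℝ :=
  fun t => (I.rv (π t), I.sv (π t))

/-- A randomized direct signaling strategy for `n` rounds (`true` is HIRE, `false` is NOT).
`hireProb t θ σ` is the probability of signaling HIRE in round `t`, provided that nobody has been
hired before, when `θ` are the valuation pairs revealed in rounds `≤ t` and `σ` are the signals sent
in rounds `< t`; it may not depend on any other entries of `θ` and `σ`. -/
structure Strategy (n : ℕ) where
  hireProb : Fin n → (Fin n → ℝ × ℝ) → (Fin n → Bool) → ℝ
  nonneg : ∀ t θ σ, 0 ≤ hireProb t θ σ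
  le_one : ∀ t θ σ, hireProb t θ σ ≤ 1
  adapted : ∀ t θ θ' σ σ', (∀ i ≤ t, θ i = θ' i) → (∀ i < t, σ i = σ' i) →
    hireProb t θ σ = hireProb t θ' σ'

/-- Probability that, while nobody is hired, the signals are `σ`, given the revealed pairs `θ`. -/
noncomputable def Strategy.signalProb {n : ℕ} (φ : Strategy n) (θ : Fin n → ℝ × ℝ)
    (σ : Fin n → Bool) : ℝ :=
  ∏ t, if σ t then φ.hireProb t θ σ else 1 - φ.hireProb t θ σ

/-- Expectation of `f`, a function of the arrival order and of the signals, over a uniformly random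
arrival order and the internal randomization of the strategy. -/
noncomputable def Strategy.expect {n : ℕ} (φ : Strategy n) (I : Instance n)
    (f : Equiv.Perm (Fin n) → (Fin n → Bool) → ℝ) : ℝ :=
  (∑ π : Equiv.Perm (Fin n), ∑ σ : Fin n → Bool, φ.signalProb (I.states π) σ * f π σ) /
    (n.factorial : ℝ)

/-- A decision rule of the receiver without disclosure: whether to hire in round `t` (if nobody has
been hired before) depends on the signals received in rounds `≤ t` only. -/
structure DecisionRule (n : ℕ) where
  hire : Fin n → (Fin n → Bool) → Prop
  adapted : ∀ t σ σ', (∀ i ≤ t, σ i = σ' i) → (hire t σ ↔ hire t σ')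

/-- The obedient rule: hire exactly upon the signal HIRE. -/
def DecisionRule.obedient (n : ℕ) : DecisionRule n where
  hire t σ := σ t = true
  adapted t σ σ' h := by rw [h t le_rfl]

/-- Using `ψ` from round `t` on, the receiver hires in round `i`. -/
def DecisionRule.HiresAt {n : ℕ} (ψ : DecisionRule n) (t : Fin n) (σ : Fin n → Bool)
    (i : Fin n) : Prop :=
  t ≤ i ∧ ψ.hire i σ ∧ ∀ j, t ≤ j → j < i → ¬ ψ.hire j σ

open Classical in
/-- Receiver's utility when she uses `ψ` from round `t` on (`0` if she never hires). -/
noncomputable def DecisionRule.payoff {n : ℕ} (ψ : DecisionRule n) (I : Instance n) (t : Fin n)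
    (π : Equiv.Perm (Fin n)) (σ : Fin n → Bool) : ℝ :=
  ∑ i, if ψ.HiresAt t σ i then I.rv (π i) else 0

open Classical in
/-- Persuasiveness without disclosure for a receiver with cardinal utility: in every round `t` that
an obedient receiver reaches, and for every possible sequence `h` of the signals received so far
(round `t` included, so only NOT before round `t`), no way of playing from round `t` on has a
strictly larger expected utility than obedience, given these signals. Both conditional expectations
are multiplied by the probability of the signals `h`. -/
def Strategy.Persuasive {n : ℕ} (φ : Strategy n) (I : Instance n) : Prop :=
  ∀ (t : Fin n) (h : Fin n → Bool), (∀ i < t, h i = false) → ∀ ψ : DecisionRule n,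
    φ.expect I (fun π σ => if ∀ i ≤ t, σ i = h i then ψ.payoff I t π σ else 0) ≤
      φ.expect I (fun π σ =>
        if ∀ i ≤ t, σ i = h i then (DecisionRule.obedient n).payoff I t π σ else 0)

open Classical in
/-- The sender's success probability with an obedient receiver: the probability that the candidate
who arrives in the round of the first HIRE signal is the best one for the sender. -/
noncomputable def Strategy.success {n : ℕ} (φ : Strategy n) (I : Instance n) : ℝ :=
  φ.expect I (fun π σ =>
    if ∃ t, (σ t = true ∧ ∀ j < t, σ j = false) ∧ ∀ k, I.sv k ≤ I.sv (π t) then 1 else 0)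

/-- The benchmark, i.e. the basic scenario without disclosure: the best success probability of a
persuasive strategy that may be designed for the given, fully known instance. -/
noncomputable def benchmarkSuccess {n : ℕ} (I : Instance n) : ℝ :=
  sSup {p | ∃ φ : Strategy n, φ.Persuasive I ∧ p = φ.success I}

/-! ## The Pareto procedure -/

section Pareto

variable {ι : Type*}

/-- The Pareto frontier of a set in the plane: its points that are not dominated by another one. -/
def paretoFrontier (C : Set (ℝ × ℝ)) : Set (ℝ × ℝ) :=
  {p | p ∈ C ∧ ∀ q ∈ C, p.1 ≤ q.1 → p.2 ≤ q.2 → q = p}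

/-- The average receiver value of the candidates in `A`. -/
noncomputable def mean (A : Finset ι) (ρ : ι → ℝ) : ℝ := (∑ i ∈ A, ρ i) / (A.card : ℝ)

/-- `(a, b)` is a pair found by the Pareto procedure on the candidates in `A` with receiver values
`ρ` and sender values `ξ`: the sender's favorite `c` twice if its receiver value is at least the
average, and otherwise the ends of a segment of the Pareto frontier of the convex hull that meets
the vertical line through the average receiver value. -/
def IsParetoPair (A : Finset ι) (ρ ξ : ι → ℝ) (a b : ι) : Prop :=
  ∃ c ∈ A, (∀ j ∈ A, ξ j ≤ ξ c) ∧
    ((mean A ρ ≤ ρ c ∧ a = c ∧ b = c) ∨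
     (ρ c < mean A ρ ∧ a ∈ A ∧ b ∈ A ∧
      segment ℝ (ρ a, ξ a) (ρ b, ξ b) ⊆
        paretoFrontier (convexHull ℝ ((fun i => (ρ i, ξ i)) '' (A : Set ι))) ∧
      ∃ p ∈ segment ℝ (ρ a, ξ a) (ρ b, ξ b), p.1 = mean A ρ))

open Classical in
/-- The weight `α` of `a`. -/
noncomputable def paretoWeight (A : Finset ι) (ρ ξ : ι → ℝ) (a b : ι) : ℝ :=
  if ρ a = ρ b then 1
  else if ξ a = ξ b then 0
  else (mean A ρ - ρ b) / (ρ a - ρ b)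

/-- The pair `(a, b)` used by the Pareto procedure. -/
noncomputable def paretoPair [Nonempty ι] (A : Finset ι) (ρ ξ : ι → ℝ) : ι × ι :=
  Classical.epsilon fun ab => IsParetoPair A ρ ξ ab.1 ab.2

/-- A pair as in `IsParetoPair` exists if the sender only values one candidate. -/
theorem exists_isParetoPair (A : Finset ι) (ρ ξ : ι → ℝ) (c : ι) (hc : c ∈ A) (h1 : ξ c = 1)
    (h0 : ∀ j ∈ A, j ≠ c → ξ j = 0) : ∃ a b, IsParetoPair A ρ ξ a b := by
  have hmax : ∀ j ∈ A, ξ j ≤ ξ c := by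
    intro j hj
    by_cases h : j = c
    · rw [h]
    · rw [h0 j hj h, h1]; exact zero_le_one
  rcases le_or_gt (mean A ρ) (ρ c) with hle | hlt
  · exact ⟨c, c, c, hc, hmax, Or.inl ⟨hle, rfl, rfl⟩⟩
  obtain ⟨b, hb, hbmax⟩ := A.exists_max_image ρ ⟨c, hc⟩
  have hpos : (0 : ℝ) < A.card := by exact_mod_cast Finset.card_pos.2 ⟨c, hc⟩
  have hmb : mean A ρ ≤ ρ b := by
    unfold mean
    rw [div_le_iff₀ hpos]
    calc ∑ i ∈ A, ρ i ≤ A.card • ρ b := Finset.sum_le_card_nsmul A ρ _ hbmax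
      _ = ρ b * A.card := by rw [nsmul_eq_mul, mul_comm]
  have hcb : ρ c < ρ b := hlt.trans_le hmb
  have hne : b ≠ c := fun h => by rw [h] at hcb; exact lt_irrefl _ hcb
  have hξb : ξ b = 0 := h0 b hb hne
  refine ⟨c, b, c, hc, hmax, Or.inr ⟨hlt, hc, hb, ?_, ?_⟩⟩
  · have hhull : ∀ q ∈ convexHull ℝ ((fun i => (ρ i, ξ i)) '' (A : Set ι)),
        q.1 + (ρ b - ρ c) * q.2 ≤ ρ b := by
      have hconv : Convex ℝ {q : ℝ × ℝ | q.1 + (ρ b - ρ c) * q.2 ≤ ρ b} := by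
        intro x hx y hy u v hu hv huv
        simp only [Set.mem_ofPred_eq, Prod.fst_add, Prod.snd_add, Prod.smul_fst, Prod.smul_snd,
          smul_eq_mul] at hx hy ⊢
        have e : ρ b = u * ρ b + v * ρ b := by rw [← add_mul, huv, one_mul]
        nlinarith [mul_le_mul_of_nonneg_left hx hu, mul_le_mul_of_nonneg_left hy hv]
      refine fun q hq => convexHull_min ?_ hconv hq
      rintro _ ⟨i, hi, rfl⟩
      simp only [Set.mem_ofPred_eq]
      by_cases h : i = c
      · rw [h, h1]; linarith
      · rw [h0 i hi h]; linarith [hbmax i hi]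
    rintro p ⟨u, v, hu, hv, huv, rfl⟩
    have hmem : ∀ i ∈ A, (ρ i, ξ i) ∈ convexHull ℝ ((fun i => (ρ i, ξ i)) '' (A : Set ι)) :=
      fun i hi => subset_convexHull ℝ _ ⟨i, hi, rfl⟩
    refine ⟨(convex_convexHull ℝ _) (hmem c hc) (hmem b hb) hu hv huv, ?_⟩
    intro q hq h1' h2'
    have hq' := hhull q hq
    simp only [Prod.fst_add, Prod.snd_add, Prod.smul_fst, Prod.smul_snd, smul_eq_mul, h1, hξb]
      at h1' h2'
    obtain rfl : v = 1 - u := by linarith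
    have hd : 0 < ρ b - ρ c := by linarith
    have hq2 : q.2 = u := by
      apply le_antisymm _ (by linarith)
      nlinarith
    ext
    · simp only [Prod.fst_add, Prod.smul_fst, smul_eq_mul]
      rw [hq2] at hq'
      linarith
    · simp [hq2, h1, hξb]
  · have hd : 0 < ρ b - ρ c := by linarith
    refine ⟨_, ⟨(ρ b - mean A ρ) / (ρ b - ρ c), (mean A ρ - ρ c) / (ρ b - ρ c), ?_, ?_, ?_, rfl⟩, ?_⟩
    · exact div_nonneg (by linarith) hd.le
    · exact div_nonneg (by linarith) hd.le
    · field_simp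
      ring
    · simp only [Prod.fst_add, Prod.smul_fst, smul_eq_mul]
      field_simp
      ring

/-- Probability that the number `x`, drawn uniformly from `[0, 1]`, satisfies `x ≤ α` for the weight
`α` of the first candidate of the pair. -/
noncomputable def paretoFirstProb [Nonempty ι] (A : Finset ι) (ρ ξ : ι → ℝ) : ℝ :=
  max 0 (min 1 (paretoWeight A ρ ξ (paretoPair A ρ ξ).1 (paretoPair A ρ ξ).2))

open Classical in
/-- Probability that the Pareto procedure returns `i`: it returns `a` if `x ≤ α` and `b` otherwise. -/
noncomputable def paretoReturnProb [Nonempty ι] (A : Finset ι) (ρ ξ : ι → ℝ) (i : ι) : ℝ :=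
  (if i = (paretoPair A ρ ξ).1 then paretoFirstProb A ρ ξ else 0) +
    (if i = (paretoPair A ρ ξ).2 then 1 - paretoFirstProb A ρ ξ else 0)

theorem paretoReturnProb_mem [Nonempty ι] (A : Finset ι) (ρ ξ : ι → ℝ) (i : ι) :
    0 ≤ paretoReturnProb A ρ ξ i ∧ paretoReturnProb A ρ ξ i ≤ 1 := by
  have h0 : 0 ≤ paretoFirstProb A ρ ξ := le_max_left _ _
  have h1 : paretoFirstProb A ρ ξ ≤ 1 := max_le zero_le_one (min_le_left _ _)
  unfold paretoReturnProb
  split_ifs <;> constructor <;> linarith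

/-- Receiver values scaled such that the maximum over `A` is `1`. -/
noncomputable def scaledValue (A : Finset ι) (ρ : ι → ℝ) (i : ι) : ℝ :=
  ρ i / sSup (ρ '' (A : Set ι))

open Classical in
/-- Sender values for ordinal sender utility: `1` for the sender's best candidate in `A`, else `0`. -/
noncomputable def ordinalValue (A : Finset ι) (ξ : ι → ℝ) (i : ι) : ℝ :=
  if ∀ j ∈ A, ξ j ≤ ξ i then 1 else 0

end Pareto

/-- Probability that the Pareto procedure for ordinal sender utility, applied to the set `A` of
valuation pairs (receiver value, sender value), returns `c`. -/
noncomputable def ordinalParetoProb (A : Finset (ℝ × ℝ)) (c : ℝ × ℝ) : ℝ :=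
  paretoReturnProb A (scaledValue A Prod.fst) (ordinalValue A Prod.snd) c

/-! ## The Growing Pareto mechanism -/

open Classical in
/-- The set of valuation pairs revealed in the rounds up to `t`. -/
noncomputable def arrived {n : ℕ} (θ : Fin n → ℝ × ℝ) (t : Fin n) : Finset (ℝ × ℝ) :=
  (Finset.Iic t).image θ

open Classical in
/-- The Growing Pareto mechanism with sample size `s` for ordinal sender utility. Round `t` is the
`(t + 1)`-st one. It does not depend on the instance except through the revealed pairs. -/
noncomputable def growingPareto (n s : ℕ) : Strategy n where
  hireProb t θ σ :=
    if ∃ i < t, σ i = true then 0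
    else if (t : ℕ) + 1 = n then 1
    else if (t : ℕ) + 1 ≤ s then 0
    else ordinalParetoProb (arrived θ t) (θ t)
  nonneg t θ σ := by
    split_ifs
    exacts [le_rfl, zero_le_one, le_rfl, (paretoReturnProb_mem _ _ _ _).1]
  le_one t θ σ := by
    split_ifs
    exacts [zero_le_one, le_rfl, zero_le_one, (paretoReturnProb_mem _ _ _ _).2]
  adapted t θ θ' σ σ' hθ hσ := by
    have h1 : arrived θ t = arrived θ' t :=
      Finset.image_congr fun i hi => hθ i (by simpa using hi)
    have h2 : (∃ i < t, σ i = true) ↔ ∃ i < t, σ' i = true :=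
      exists_congr fun i => and_congr_right fun hi => by rw [hσ i hi]
    simp only [h1, h2, hθ t le_rfl]

end OnlinePersuasion

namespace OnlinePersuasion

/-! ### The Pareto procedure with a 0-1 sender value -/

section Pareto
variable {ι : Type*}

/-! With a 0-1 sender value the Pareto procedure on a set `B` is a lottery between the sender's
favorite `c` and the receiver's favorite `b` of `B`. The weight of `c` is the largest one for which
the lottery is worth at least the mean of `B` to the receiver; call it `q(B)` (`favoriteProb`).

Persuasiveness. Given the set of the first `t` candidates and the order of all later rounds, the
candidate of round `t` is uniform on that set. The return probabilities sum to 1, so outside the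
sample and the last round a HIRE in round `t` has conditional probability `1/t`, whatever the set
and the future (`sum_roundProb_mul`). The round of the first HIRE is therefore independent of all
later arrivals (`sum_hireAtProb_mul`), while the candidate hired in it is worth at least the overall
mean `μ` on average (`le_sum_hireAtProb_mul_self`). After HIRE, waiting yields only `μ`. After NOT,
hiring in round `i` without a signal is no better than `μ`: round `i` is worth `μ` overall, exactly
`μ` if HIRE came earlier and at least `μ` if it comes in round `i`, hence at most `μ` if it comes
later (`sum_hireValue_le`).

Benchmark. A receiver who takes the first candidate gets `μ`, and an obedient one gets at most `p
ρ_c + (1 - p) ρ_b`, where `p` is the success probability. So persuasiveness forces `p ≤ q` for `q =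
q(all candidates)` (`Strategy.Persuasive.success_le`).

Success. Deleting a random element other than `c` from a set of `m` candidates costs at most a
factor `(m - 2)/(m - 1)` in `q` (`returnProb_le_sum_erase`). Iterated from the full set, this shows
that the procedure on the first `t` candidates returns `c` with probability at least `q t(t -
1)/(n(n - 1))`. Round `t` is reached without HIRE with probability `s/(t - 1)`, and `c` arrives
exactly then with conditional probability `1/t`; so each of the `n - 1 - s` rounds strictly between
sample and end contributes at least `q s/(n(n - 1))`. For `s = ⌊n/2⌋` the total tends to `q/4`. -/

theorem mean_lt_of_forall_le_of_lt {A : Finset ι} {ρ : ι → ℝ} {b c : ι} (hb : ∀ j ∈ A, ρ j ≤ ρ b)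
    (hc : c ∈ A) (hcb : ρ c < ρ b) : mean A ρ < ρ b := by
  have hpos : (0 : ℝ) < A.card := by exact_mod_cast Finset.card_pos.2 ⟨c, hc⟩
  rw [mean, div_lt_iff₀ hpos]
  calc ∑ i ∈ A, ρ i < ∑ _i ∈ A, ρ b := Finset.sum_lt_sum hb ⟨c, hc, hcb⟩
    _ = ρ b * A.card := by rw [Finset.sum_const, nsmul_eq_mul, mul_comm]

theorem mean_le_of_forall_le {A : Finset ι} {ρ : ι → ℝ} {b : ι} (hA : A.Nonempty)
    (hb : ∀ j ∈ A, ρ j ≤ ρ b) : mean A ρ ≤ ρ b := by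
  have hpos : (0 : ℝ) < A.card := by exact_mod_cast Finset.card_pos.2 hA
  rw [mean, div_le_iff₀ hpos]
  calc ∑ i ∈ A, ρ i ≤ ∑ _i ∈ A, ρ b := Finset.sum_le_sum hb
    _ = ρ b * A.card := by rw [Finset.sum_const, nsmul_eq_mul, mul_comm]

/-- The largest weight `p ≤ 1` of `c` for which the lottery between `c` and the receiver's favorite
`b` is on average at least as good for the receiver as the mean of `A`. -/
noncomputable def favoriteProb (A : Finset ι) (ρ : ι → ℝ) (c b : ι) : ℝ :=
  if mean A ρ ≤ ρ c then 1 else (ρ b - mean A ρ) / (ρ b - ρ c)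

theorem favoriteProb_mem {A : Finset ι} {ρ : ι → ℝ} {c b : ι} (hc : c ∈ A)
    (hb : ∀ j ∈ A, ρ j ≤ ρ b) : 0 ≤ favoriteProb A ρ c b ∧ favoriteProb A ρ c b ≤ 1 := by
  have hm := mean_le_of_forall_le ⟨c, hc⟩ hb
  unfold favoriteProb
  split_ifs with h
  · exact ⟨zero_le_one, le_rfl⟩
  · push Not at h
    have hd : 0 < ρ b - ρ c := by linarith
    exact ⟨div_nonneg (by linarith) hd.le, (div_le_one hd).2 (by linarith)⟩

theorem mean_le_favoriteProb_lottery {A : Finset ι} {ρ : ι → ℝ} {c b : ι} (hc : c ∈ A)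
    (hb : ∀ j ∈ A, ρ j ≤ ρ b) :
    mean A ρ ≤ favoriteProb A ρ c b * ρ c + (1 - favoriteProb A ρ c b) * ρ b := by
  have hm := mean_le_of_forall_le ⟨c, hc⟩ hb
  unfold favoriteProb
  split_ifs with h
  · linarith
  · push Not at h
    have hd : ρ b - ρ c ≠ 0 := by linarith
    apply le_of_eq
    field_simp
    ring

/-- Every candidate other than `c` and `b` has sender value 0 and is dominated by `b`, so a frontier
segment between candidates can only end in `c` or `b`. The degenerate segments miss the vertical
line because `ρ c < mean A ρ < ρ b`. -/
theorem isParetoPair_of_indicator {A : Finset ι} {ρ ξ : ι → ℝ} {c b x y : ι} (hc : c ∈ A)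
    (h1 : ξ c = 1) (h0 : ∀ j ∈ A, j ≠ c → ξ j = 0) (hb : b ∈ A)
    (hbmax : ∀ j ∈ A, j ≠ b → ρ j < ρ b) (hp : IsParetoPair A ρ ξ x y) :
    (mean A ρ ≤ ρ c ∧ x = c ∧ y = c) ∨
      (ρ c < mean A ρ ∧ c ≠ b ∧ ((x = c ∧ y = b) ∨ (x = b ∧ y = c))) := by
  obtain ⟨c', hc', hmax, h⟩ := hp
  have hcc : c' = c := by
    by_contra hne
    have := hmax c hc
    rw [h1, h0 c' hc' hne] at this
    linarith
  subst hcc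
  have hble : ∀ j ∈ A, ρ j ≤ ρ b := fun j hj => by
    by_cases hjb : j = b
    · rw [hjb]
    · exact (hbmax j hj hjb).le
  rcases h with h | ⟨hlt, hx, hy, hseg, p, hp, hpm⟩
  · exact Or.inl h
  right
  have hmb := mean_le_of_forall_le ⟨c', hc⟩ hble
  have hcb : c' ≠ b := fun h => by rw [h] at hlt; linarith
  have hmb' := mean_lt_of_forall_le_of_lt hble hc (hlt.trans_le hmb)
  -- A candidate on a frontier segment is itself non-dominated; comparison with `b` leaves only `c'`
  -- and `b`.
  have key : ∀ z ∈ A, (ρ z, ξ z) ∈ segment ℝ (ρ x, ξ x) (ρ y, ξ y) → z = c' ∨ z = b := by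
    intro z hz hzs
    by_contra! hne
    have h2 := (hseg hzs).2 (ρ b, ξ b) (subset_convexHull ℝ _ ⟨b, hb, rfl⟩)
      (hbmax z hz hne.2).le (by simp only [h0 z hz hne.1, h0 b hb hcb.symm, le_refl])
    have := congrArg Prod.fst h2
    simp only at this
    linarith [hbmax z hz hne.2]
  refine ⟨hlt, hcb, ?_⟩
  rcases key x hx (left_mem_segment ℝ _ _) with hx' | hx' <;>
    rcases key y hy (right_mem_segment ℝ _ _) with hy' | hy'
  · rw [hx', hy', segment_same, Set.mem_singleton_iff] at hp
    rw [hp] at hpm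
    simp only at hpm
    linarith
  · exact Or.inl ⟨hx', hy'⟩
  · exact Or.inr ⟨hx', hy'⟩
  · rw [hx', hy', segment_same, Set.mem_singleton_iff] at hp
    rw [hp] at hpm
    simp only at hpm
    linarith

open Classical in
-- The choice operator may return the ends in either order, but exchanging them turns the weight
-- into its complement, so the lottery is the same.
theorem paretoReturnProb_of_indicator [Nonempty ι] {A : Finset ι} {ρ ξ : ι → ℝ} {c b : ι}
    (hc : c ∈ A) (h1 : ξ c = 1) (h0 : ∀ j ∈ A, j ≠ c → ξ j = 0) (hb : b ∈ A)
    (hbmax : ∀ j ∈ A, j ≠ b → ρ j < ρ b) (i : ι) :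
    paretoReturnProb A ρ ξ i = (if i = c then favoriteProb A ρ c b else 0) +
      (if i = b then 1 - favoriteProb A ρ c b else 0) := by
  have hex : ∃ ab : ι × ι, IsParetoPair A ρ ξ ab.1 ab.2 := by
    obtain ⟨a, b, h⟩ := exists_isParetoPair A ρ ξ c hc h1 h0
    exact ⟨(a, b), h⟩
  have hspec : IsParetoPair A ρ ξ (paretoPair A ρ ξ).1 (paretoPair A ρ ξ).2 :=
    Classical.epsilon_spec hex
  have hble : ∀ j ∈ A, ρ j ≤ ρ b := fun j hj => by
    by_cases hjb : j = b
    · rw [hjb]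
    · exact (hbmax j hj hjb).le
  have hmem := favoriteProb_mem hc hble
  rcases isParetoPair_of_indicator hc h1 h0 hb hbmax hspec with ⟨hm, hx, hy⟩ | ⟨hm, hcb, h⟩
  · have hf : favoriteProb A ρ c b = 1 := if_pos hm
    rw [hf]
    unfold paretoReturnProb
    rw [hx, hy]
    split_ifs <;> simp
  · have hf : favoriteProb A ρ c b = (ρ b - mean A ρ) / (ρ b - ρ c) := if_neg (not_le.2 hm)
    have hlt := hbmax c hc hcb
    have hξb := h0 b hb hcb.symm
    have hd : ρ b - ρ c ≠ 0 := by linarith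
    have hd' : ρ c - ρ b ≠ 0 := by linarith
    unfold paretoReturnProb paretoFirstProb
    rcases h with ⟨hx, hy⟩ | ⟨hx, hy⟩
    · have hw : paretoWeight A ρ ξ c b = favoriteProb A ρ c b := by
        rw [paretoWeight, if_neg hlt.ne, h1, hξb, if_neg one_ne_zero, hf, div_eq_div_iff hd' hd]
        ring
      rw [hx, hy, hw, min_eq_right hmem.2, max_eq_right hmem.1]
    · have hw : paretoWeight A ρ ξ b c = 1 - favoriteProb A ρ c b := by
        rw [paretoWeight, if_neg hlt.ne', h1, hξb, if_neg zero_ne_one, hf]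
        field_simp
        ring
      rw [hx, hy, hw, min_eq_right (by linarith [hmem.1]), max_eq_right (by linarith [hmem.2]),
        sub_sub_cancel, add_comm]

theorem mean_div (A : Finset ι) (ρ : ι → ℝ) (m : ℝ) : mean A (fun i => ρ i / m) = mean A ρ / m := by
  rw [mean, mean, ← Finset.sum_div, div_right_comm]

theorem favoriteProb_div {A : Finset ι} {ρ : ι → ℝ} {m : ℝ} (hm : 0 < m) (c b : ι) :
    favoriteProb A (fun i => ρ i / m) c b = favoriteProb A ρ c b := by
  unfold favoriteProb
  rw [mean_div]
  simp only [div_le_div_iff_of_pos_right hm, ← sub_div]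
  rw [div_div_div_cancel_right₀ hm.ne']

theorem favoriteProb_singleton (ρ : ι → ℝ) (c b : ι) : favoriteProb {c} ρ c b = 1 := by
  simp [favoriteProb, mean]

end Pareto

open Classical in
theorem ordinalParetoProb_eq {A : Finset (ℝ × ℝ)} {c b : ℝ × ℝ} (hnn : ∀ p ∈ A, 0 ≤ p.1)
    (hc : c ∈ A) (hcmax : ∀ p ∈ A, p ≠ c → p.2 < c.2) (hb : b ∈ A)
    (hbmax : ∀ p ∈ A, p ≠ b → p.1 < b.1) (x : ℝ × ℝ) :
    ordinalParetoProb A x = (if x = c then favoriteProb A Prod.fst c b else 0) +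
      (if x = b then 1 - favoriteProb A Prod.fst c b else 0) := by
  have h1 : ordinalValue A Prod.snd c = 1 := by
    refine if_pos fun j hj => ?_
    by_cases h : j = c
    · rw [h]
    · exact (hcmax j hj h).le
  have h0 : ∀ j ∈ A, j ≠ c → ordinalValue A Prod.snd j = 0 := fun j hj hne =>
    if_neg fun h => absurd (h c hc) (not_le.2 (hcmax j hj hne))
  have hble : ∀ j ∈ A, j.1 ≤ b.1 := fun j hj => by
    by_cases hjb : j = b
    · rw [hjb]
    · exact (hbmax j hj hjb).le
  have hsup : sSup (Prod.fst '' (A : Set (ℝ × ℝ))) = b.1 :=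
    IsGreatest.csSup_eq ⟨⟨b, hb, rfl⟩, by rintro _ ⟨j, hj, rfl⟩; exact hble j hj⟩
  -- A single candidate may have receiver value 0, and then scaling divides by 0. With two
  -- candidates, distinctness and non-negativity make the maximum positive.
  by_cases hone : ∀ j ∈ A, j = c
  · have hA : A = {c} := Finset.eq_singleton_iff_unique_mem.2 ⟨hc, hone⟩
    have hbc := hone b hb
    unfold ordinalParetoProb
    rw [paretoReturnProb_of_indicator hc h1 h0 hb (fun j hj hne => absurd
      ((hone j hj).trans hbc.symm) hne), hA, favoriteProb_singleton, favoriteProb_singleton]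
    congr
  · push Not at hone
    obtain ⟨j, hj, hjc⟩ := hone
    have hpos : 0 < b.1 := by
      by_cases h : j = b
      · exact (hnn c hc).trans_lt (hbmax c hc (h ▸ hjc.symm))
      · exact (hnn j hj).trans_lt (hbmax j hj h)
    have hs : scaledValue A Prod.fst = fun i : ℝ × ℝ => i.1 / b.1 := by
      funext i
      rw [scaledValue, hsup]
    unfold ordinalParetoProb
    rw [hs, paretoReturnProb_of_indicator hc h1 h0 hb (fun j hj hne =>
      div_lt_div_of_pos_right (hbmax j hj hne) hpos), favoriteProb_div hpos]
    congr

/-! ## The Pareto procedure on sets of candidates -/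

namespace Instance
variable {n : ℕ} (I : Instance n)

/-- The valuation pair of a candidate. -/
def pair (i : Fin n) : ℝ × ℝ := (I.rv i, I.sv i)

theorem pair_injective : Function.Injective I.pair := fun _ _ h =>
  I.rv_injective (congrArg Prod.fst h)

open Classical in
/-- Probability that the Pareto procedure on the candidates in `B` returns `i`. -/
noncomputable def returnProb (B : Finset (Fin n)) (i : Fin n) : ℝ :=
  ordinalParetoProb (B.image I.pair) (I.pair i)

theorem returnProb_nonneg (B : Finset (Fin n)) (i : Fin n) : 0 ≤ I.returnProb B i :=
  (paretoReturnProb_mem _ _ _ _).1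

theorem returnProb_eq {B : Finset (Fin n)} {c b : Fin n} (hc : c ∈ B)
    (hcmax : ∀ j ∈ B, I.sv j ≤ I.sv c) (hb : b ∈ B) (hbmax : ∀ j ∈ B, I.rv j ≤ I.rv b)
    (i : Fin n) :
    I.returnProb B i = (if i = c then favoriteProb B I.rv c b else 0) +
      (if i = b then 1 - favoriteProb B I.rv c b else 0) := by
  classical
  have hmean : mean (B.image I.pair) Prod.fst = mean B I.rv := by
    rw [mean, mean, Finset.sum_image fun _ _ _ _ h => I.pair_injective h,
      Finset.card_image_of_injective _ I.pair_injective]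
    rfl
  have hfav : favoriteProb (B.image I.pair) Prod.fst (I.pair c) (I.pair b) =
      favoriteProb B I.rv c b := by
    unfold favoriteProb
    rw [hmean]
    rfl
  rw [← hfav, returnProb]
  convert ordinalParetoProb_eq (A := B.image I.pair) (c := I.pair c) (b := I.pair b) ?_ ?_ ?_ ?_ ?_
    (I.pair i) using 2
  · simp only [I.pair_injective.eq_iff]
  · simp only [I.pair_injective.eq_iff]
  · simp only [Finset.mem_image, forall_exists_index, and_imp]
    rintro _ j _ rfl
    exact I.rv_nonneg j
  · exact Finset.mem_image_of_mem _ hc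
  · simp only [Finset.mem_image, forall_exists_index, and_imp]
    rintro _ j hj rfl hne
    exact (hcmax j hj).lt_of_ne fun h => hne (congrArg _ (I.sv_injective h))
  · exact Finset.mem_image_of_mem _ hb
  · simp only [Finset.mem_image, forall_exists_index, and_imp]
    rintro _ j hj rfl hne
    exact (hbmax j hj).lt_of_ne fun h => hne (congrArg _ (I.rv_injective h))

theorem sum_returnProb_mul {B : Finset (Fin n)} {c b : Fin n} (hc : c ∈ B)
    (hcmax : ∀ j ∈ B, I.sv j ≤ I.sv c) (hb : b ∈ B) (hbmax : ∀ j ∈ B, I.rv j ≤ I.rv b)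
    (f : Fin n → ℝ) :
    ∑ i ∈ B, I.returnProb B i * f i =
      favoriteProb B I.rv c b * f c + (1 - favoriteProb B I.rv c b) * f b := by
  simp only [I.returnProb_eq hc hcmax hb hbmax, add_mul, ite_mul, zero_mul,
    Finset.sum_add_distrib, Finset.sum_ite_eq', hc, hb, if_true]

theorem sum_returnProb {B : Finset (Fin n)} (hB : B.Nonempty) : ∑ i ∈ B, I.returnProb B i = 1 := by
  obtain ⟨c, hc, hcmax⟩ := B.exists_max_image I.sv hB
  obtain ⟨b, hb, hbmax⟩ := B.exists_max_image I.rv hB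
  have := I.sum_returnProb_mul hc hcmax hb hbmax fun _ => 1
  simp only [mul_one] at this
  rw [this]
  ring

theorem mean_le_sum_returnProb_mul {B : Finset (Fin n)} (hB : B.Nonempty) :
    mean B I.rv ≤ ∑ i ∈ B, I.returnProb B i * I.rv i := by
  obtain ⟨c, hc, hcmax⟩ := B.exists_max_image I.sv hB
  obtain ⟨b, hb, hbmax⟩ := B.exists_max_image I.rv hB
  rw [I.sum_returnProb_mul hc hcmax hb hbmax]
  exact mean_le_favoriteProb_lottery hc hbmax

theorem returnProb_favorite {B : Finset (Fin n)} {c b : Fin n} (hc : c ∈ B)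
    (hcmax : ∀ j ∈ B, I.sv j ≤ I.sv c) (hb : b ∈ B) (hbmax : ∀ j ∈ B, I.rv j ≤ I.rv b) :
    I.returnProb B c = favoriteProb B I.rv c b := by
  rw [I.returnProb_eq hc hcmax hb hbmax, if_pos rfl]
  split_ifs with h
  · subst h
    rw [favoriteProb, if_pos (mean_le_of_forall_le ⟨c, hc⟩ hbmax)]
    ring
  · ring

end Instance

/-! ## Random arrival orders -/

section Order
variable {n : ℕ}

/-- The first `t` candidates in the arrival order `π`. -/
def front (π : Equiv.Perm (Fin n)) (t : ℕ) : Finset (Fin n) :=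
  Finset.univ.filter fun x => (π.symm x : ℕ) < t

theorem mem_front {π : Equiv.Perm (Fin n)} {t : ℕ} {x : Fin n} :
    x ∈ front π t ↔ (π.symm x : ℕ) < t := by simp [front]

theorem apply_mem_front {π : Equiv.Perm (Fin n)} {t : ℕ} {i : Fin n} :
    π i ∈ front π t ↔ (i : ℕ) < t := by simp [front]

theorem front_eq_map (π : Equiv.Perm (Fin n)) (j : Fin n) :
    front π (j + 1) = (Finset.Iic j).map π.toEmbedding := by
  ext x
  rw [Finset.mem_map_equiv, mem_front, Finset.mem_Iic, Fin.le_def, Nat.lt_succ_iff]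

theorem card_front (π : Equiv.Perm (Fin n)) (j : Fin n) : (front π (j + 1)).card = j + 1 := by
  rw [front_eq_map, Finset.card_map, Fin.card_Iic]

theorem front_eq_univ (π : Equiv.Perm (Fin n)) : front π n = Finset.univ :=
  Finset.filter_true_of_mem fun x _ => (π.symm x).2

theorem front_erase (π : Equiv.Perm (Fin n)) (j : Fin n) :
    (front π (j + 1)).erase (π j) = front π j := by
  ext x
  rw [Finset.mem_erase, mem_front, mem_front, Nat.lt_succ_iff, Nat.lt_iff_le_and_ne, and_comm]
  refine and_congr_right fun _ => not_congr ?_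
  rw [← Fin.ext_iff, Equiv.symm_apply_eq]

/-- `g` does not depend on the order in which the first `t` candidates arrive. -/
def OrderInvariant {α : Type*} (t : ℕ) (g : Equiv.Perm (Fin n) → α) : Prop :=
  ∀ i k : Fin n, (i : ℕ) < t → (k : ℕ) < t → ∀ π, g (π * Equiv.swap i k) = g π

theorem OrderInvariant.mono {α : Type*} {t u : ℕ} {g : Equiv.Perm (Fin n) → α}
    (hg : OrderInvariant u g) (h : t ≤ u) : OrderInvariant t g :=
  fun i k hi hk => hg i k (hi.trans_le h) (hk.trans_le h)

theorem OrderInvariant.comp₂ {α β γ : Type*} {t : ℕ} {g : Equiv.Perm (Fin n) → α}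
    {h : Equiv.Perm (Fin n) → β} (hg : OrderInvariant t g) (hh : OrderInvariant t h)
    (f : α → β → γ) : OrderInvariant t fun π => f (g π) (h π) :=
  fun i k hi hk π => by simp only [hg i k hi hk, hh i k hi hk]

theorem orderInvariant_const {α : Type*} (t : ℕ) (a : α) :
    OrderInvariant t fun _ : Equiv.Perm (Fin n) => a := fun _ _ _ _ _ => rfl

theorem orderInvariant_apply {t : ℕ} {j : Fin n} (h : t ≤ j) :
    OrderInvariant t fun π : Equiv.Perm (Fin n) => π j := fun i k hi hk π => by
  have h1 : j ≠ i := fun e => by rw [e] at h; omega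
  have h2 : j ≠ k := fun e => by rw [e] at h; omega
  simp only [Equiv.Perm.mul_apply, Equiv.swap_apply_of_ne_of_ne h1 h2]

theorem orderInvariant_front {t u : ℕ} (h : t ≤ u) :
    OrderInvariant t fun π : Equiv.Perm (Fin n) => front π u := fun i k hi hk π => by
  ext x
  rw [mem_front, mem_front]
  have : (π * Equiv.swap i k).symm x = Equiv.swap i k (π.symm x) := by
    rw [Equiv.symm_apply_eq, Equiv.Perm.mul_apply, Equiv.swap_apply_self, Equiv.apply_symm_apply]
  rw [this, Equiv.swap_apply_def]
  split_ifs with h1 h2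
  · rw [h1]; omega
  · rw [h2]; omega
  · rfl

/-- The candidate of round `j` is uniformly distributed among those of the rounds `≤ j`. -/
theorem sum_apply_eq_sum_front (j : Fin n) {K : Equiv.Perm (Fin n) → Fin n → ℝ}
    (hK : OrderInvariant (j + 1) K) :
    ((j : ℝ) + 1) * ∑ π : Equiv.Perm (Fin n), K π (π j) =
      ∑ π : Equiv.Perm (Fin n), ∑ x ∈ front π (j + 1), K π x := by
  -- Exchanging the rounds `i` and `j` is a bijection of the arrival orders that leaves `K`
  -- unchanged, so all rounds up to `j` give the same sum.
  have h : ∀ i ∈ Finset.Iic j, ∑ π : Equiv.Perm (Fin n), K π (π i) =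
      ∑ π : Equiv.Perm (Fin n), K π (π j) := by
    intro i hi
    rw [Finset.mem_Iic, Fin.le_def] at hi
    rw [← Equiv.sum_comp (Equiv.mulRight (Equiv.swap i j))]
    refine Finset.sum_congr rfl fun π _ => ?_
    rw [Equiv.coe_mulRight, hK i j (by omega) (by omega), Equiv.Perm.mul_apply,
      Equiv.swap_apply_left]
  simp only [front_eq_map, Finset.sum_map, Equiv.coe_toEmbedding]
  rw [Finset.sum_comm, Finset.sum_congr rfl h, Finset.sum_const, Fin.card_Iic, nsmul_eq_mul]
  push_cast
  rfl

theorem sum_apply_eq_sum_apply (f : Fin n → ℝ) (i j : Fin n) :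
    ∑ π : Equiv.Perm (Fin n), f (π i) = ∑ π : Equiv.Perm (Fin n), f (π j) := by
  rw [← Equiv.sum_comp (Equiv.mulRight (Equiv.swap i j))]
  refine Finset.sum_congr rfl fun π _ => ?_
  rw [Equiv.coe_mulRight, Equiv.Perm.mul_apply, Equiv.swap_apply_left]

theorem sum_apply_eq_mean (ρ : Fin n → ℝ) (j : Fin n) :
    ∑ π : Equiv.Perm (Fin n), ρ (π j) = n.factorial * mean Finset.univ ρ := by
  have hn : (n : ℝ) ≠ 0 := by exact_mod_cast (Fin.pos j).ne'
  have h : ∑ i, ∑ π : Equiv.Perm (Fin n), ρ (π i) = n.factorial * ∑ i, ρ i := by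
    rw [Finset.sum_comm]
    simp only [Equiv.sum_comp]
    rw [Finset.sum_const, Finset.card_univ, Fintype.card_perm, Fintype.card_fin, nsmul_eq_mul]
  rw [Finset.sum_congr rfl fun i _ => sum_apply_eq_sum_apply ρ i j, Finset.sum_const,
    Finset.card_univ, Fintype.card_fin, nsmul_eq_mul] at h
  rw [mean, Finset.card_univ, Fintype.card_fin]
  field_simp
  rw [← h, mul_comm]

end Order

/-! ## Hiring probabilities of the Growing Pareto mechanism -/

namespace Instance
variable {n : ℕ} (I : Instance n) (s : ℕ)

/-- Probability that the Growing Pareto mechanism signals HIRE in round `t` for the arrival order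
`π`, provided that it has not done so before. -/
noncomputable def roundProb (π : Equiv.Perm (Fin n)) (t : Fin n) : ℝ :=
  if (t : ℕ) + 1 = n then 1
  else if (t : ℕ) + 1 ≤ s then 0
  else I.returnProb (front π (t + 1)) (π t)

/-- Average of `roundProb` over the arrival orders. -/
noncomputable def _root_.OnlinePersuasion.meanRoundProb (n s : ℕ) (t : ℕ) : ℝ :=
  if t + 1 = n then 1 else if t + 1 ≤ s then 0 else 1 / ((t : ℝ) + 1)

/-- Probability that there is no HIRE signal in the first `t` rounds. -/
noncomputable def noHireProb (π : Equiv.Perm (Fin n)) (t : ℕ) : ℝ :=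
  ∏ u ∈ Finset.univ.filter fun u : Fin n => (u : ℕ) < t, (1 - I.roundProb s π u)

/-- Average of `noHireProb` over the arrival orders. -/
noncomputable def _root_.OnlinePersuasion.meanNoHireProb (n s : ℕ) (t : ℕ) : ℝ :=
  ∏ u ∈ Finset.range t, (1 - meanRoundProb n s u)

/-- Probability that round `j` has the first HIRE signal. -/
noncomputable def hireAtProb (π : Equiv.Perm (Fin n)) (j : Fin n) : ℝ :=
  I.noHireProb s π j * I.roundProb s π j

theorem _root_.OnlinePersuasion.meanRoundProb_mem (n s t : ℕ) :
    0 ≤ meanRoundProb n s t ∧ meanRoundProb n s t ≤ 1 := by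
  have h : (1 : ℝ) ≤ (t : ℝ) + 1 := by simp
  unfold meanRoundProb
  split_ifs
  · exact ⟨zero_le_one, le_rfl⟩
  · exact ⟨le_rfl, zero_le_one⟩
  · exact ⟨by positivity, (div_le_one (by positivity)).2 h⟩

theorem _root_.OnlinePersuasion.meanNoHireProb_nonneg (n s t : ℕ) : 0 ≤ meanNoHireProb n s t :=
  Finset.prod_nonneg fun u _ => sub_nonneg.2 (meanRoundProb_mem n s u).2

/-- The sample contributes factors 1, and the later factors `u / (u + 1)` telescope. -/
theorem _root_.OnlinePersuasion.meanNoHireProb_eq {n s : ℕ} (hs : 1 ≤ s) :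
    ∀ {t : ℕ}, s ≤ t → t < n → meanNoHireProb n s t = (s : ℝ) / t := by
  intro t hst
  induction t, hst using Nat.le_induction with
  | base =>
    intro hn
    have : (s : ℝ) ≠ 0 := by positivity
    rw [div_self this]
    refine Finset.prod_eq_one fun u hu => ?_
    rw [Finset.mem_range] at hu
    rw [meanRoundProb, if_neg (by omega), if_pos (by omega), sub_zero]
  | succ t hst ih =>
    intro hn
    have h0 : (t : ℝ) ≠ 0 := by
      have : 0 < t := by omega
      positivity
    have h1 : (t : ℝ) + 1 ≠ 0 := by positivity
    rw [meanNoHireProb, Finset.prod_range_succ, ← meanNoHireProb, ih (by omega), meanRoundProb,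
      if_neg (by omega), if_neg (by omega)]
    push_cast
    field_simp
    ring

theorem roundProb_nonneg (π : Equiv.Perm (Fin n)) (t : Fin n) : 0 ≤ I.roundProb s π t := by
  unfold roundProb
  split_ifs
  exacts [zero_le_one, le_rfl, I.returnProb_nonneg _ _]

theorem roundProb_le_one (π : Equiv.Perm (Fin n)) (t : Fin n) : I.roundProb s π t ≤ 1 := by
  unfold roundProb
  split_ifs
  exacts [le_rfl, zero_le_one, (paretoReturnProb_mem _ _ _ _).2]

theorem hireAtProb_nonneg (π : Equiv.Perm (Fin n)) (j : Fin n) : 0 ≤ I.hireAtProb s π j :=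
  mul_nonneg (Finset.prod_nonneg fun u _ => sub_nonneg.2 (I.roundProb_le_one s π u))
    (I.roundProb_nonneg s π j)

theorem orderInvariant_roundProb {t : ℕ} {j : Fin n} (h : t ≤ j) :
    OrderInvariant t fun π => I.roundProb s π j := by
  unfold roundProb
  split_ifs
  · exact orderInvariant_const _ _
  · exact orderInvariant_const _ _
  · exact (orderInvariant_front (by omega)).comp₂ (orderInvariant_apply h) I.returnProb

/-- A HIRE in round `j` is uncorrelated with everything that ignores the order within the rounds `≤
j`: averaging over who of these candidates comes last replaces the return probability by `1 / (j +
1)`. -/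
theorem sum_roundProb_mul (j : Fin n) {g : Equiv.Perm (Fin n) → ℝ} (hg : OrderInvariant (j + 1) g) :
    ∑ π, I.roundProb s π j * g π = meanRoundProb n s j * ∑ π, g π := by
  unfold roundProb meanRoundProb
  split_ifs
  · simp
  · simp
  · have hj : (j : ℝ) + 1 ≠ 0 := by positivity
    have h := sum_apply_eq_sum_front j (K := fun π x => I.returnProb (front π (j + 1)) x * g π)
      ((orderInvariant_front le_rfl).comp₂ hg fun A y x => I.returnProb A x * y)
    simp only [← Finset.sum_mul] at h
    rw [div_mul_eq_mul_div, one_mul, eq_div_iff hj, mul_comm, h]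
    refine Finset.sum_congr rfl fun π _ => ?_
    rw [I.sum_returnProb ⟨π j, apply_mem_front.2 (Nat.lt_succ_self _)⟩, one_mul]

/-- The value of the candidate of round `j` is not invariant in the sense of `sum_roundProb_mul`.
Here the lottery's guarantee enters: it is worth at least the mean of the arrived candidates. -/
theorem mean_le_sum_roundProb_mul (j : Fin n) :
    meanRoundProb n s j * ∑ π : Equiv.Perm (Fin n), I.rv (π j) ≤
      ∑ π, I.roundProb s π j * I.rv (π j) := by
  unfold roundProb meanRoundProb
  split_ifs
  · simp
  · simp
  · have hj : 0 < (j : ℝ) + 1 := by positivity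
    have h := sum_apply_eq_sum_front j
      (K := fun π x => I.returnProb (front π (j + 1)) x * I.rv x)
      ((orderInvariant_front le_rfl).comp₂ (orderInvariant_const _ ())
        fun A _ x => I.returnProb A x * I.rv x)
    have h' := sum_apply_eq_sum_front j (K := fun _ x => I.rv x) (orderInvariant_const _ _)
    rw [← mul_le_mul_iff_right₀ hj, h, ← mul_assoc, mul_one_div_cancel hj.ne', one_mul,
      ← mul_le_mul_iff_right₀ hj, h', Finset.mul_sum]
    refine Finset.sum_le_sum fun π _ => ?_
    have := I.mean_le_sum_returnProb_mul (B := front π (j + 1))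
      ⟨π j, apply_mem_front.2 (Nat.lt_succ_self _)⟩
    rw [mean, card_front, div_le_iff₀ (by positivity)] at this
    push_cast at this
    linarith

theorem noHireProb_succ (π : Equiv.Perm (Fin n)) (j : Fin n) :
    I.noHireProb s π (j + 1) = I.noHireProb s π j * (1 - I.roundProb s π j) := by
  have : (Finset.univ.filter fun u : Fin n => (u : ℕ) < j + 1) =
      insert j (Finset.univ.filter fun u : Fin n => (u : ℕ) < j) := by
    ext u
    simp only [Finset.mem_filter_univ, Finset.mem_insert, Fin.ext_iff]
    omega
  rw [noHireProb, this, Finset.prod_insert (by simp), mul_comm]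
  rfl

theorem sum_noHireProb_mul {t : ℕ} (ht : t ≤ n) {g : Equiv.Perm (Fin n) → ℝ}
    (hg : OrderInvariant t g) :
    ∑ π, I.noHireProb s π t * g π = meanNoHireProb n s t * ∑ π, g π := by
  induction t generalizing g with
  | zero => simp [noHireProb, meanNoHireProb]
  | succ t ih =>
    have hinv : OrderInvariant t fun π => (1 - I.roundProb s π ⟨t, ht⟩) * g π :=
      (I.orderInvariant_roundProb s (j := ⟨t, ht⟩) le_rfl).comp₂ (hg.mono t.le_succ)
        fun x y => (1 - x) * y
    have h := I.sum_roundProb_mul s ⟨t, ht⟩ hg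
    have hs : ∀ π, I.noHireProb s π (t + 1) =
        I.noHireProb s π t * (1 - I.roundProb s π ⟨t, ht⟩) :=
      fun π => I.noHireProb_succ s π ⟨t, ht⟩
    -- The last factor depends only on the set of the first `t + 1` candidates and on the one of
    -- round `t`, hence not on the order before. It can be absorbed into `g`, which is why the
    -- induction generalizes `g`.
    simp only [hs, mul_assoc]
    rw [ih (by omega) hinv]
    simp only [sub_mul, one_mul, Finset.sum_sub_distrib]
    rw [h, meanNoHireProb, meanNoHireProb, Finset.prod_range_succ]
    ring

theorem sum_hireAtProb_mul (j : Fin n) {g : Equiv.Perm (Fin n) → ℝ}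
    (hg : OrderInvariant (j + 1) g) :
    ∑ π, I.hireAtProb s π j * g π =
      meanNoHireProb n s j * meanRoundProb n s j * ∑ π, g π := by
  have hinv : OrderInvariant j fun π => I.roundProb s π j * g π :=
    (I.orderInvariant_roundProb s le_rfl).comp₂ (hg.mono (Nat.le_succ _)) fun x y => x * y
  simp only [hireAtProb, mul_assoc]
  rw [I.sum_noHireProb_mul s j.2.le hinv, I.sum_roundProb_mul s j hg]

theorem le_sum_hireAtProb_mul_self (j : Fin n) :
    meanNoHireProb n s j * meanRoundProb n s j * ∑ π : Equiv.Perm (Fin n), I.rv (π j) ≤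
      ∑ π, I.hireAtProb s π j * I.rv (π j) := by
  have hinv : OrderInvariant j fun π => I.roundProb s π j * I.rv (π j) :=
    (I.orderInvariant_roundProb s le_rfl).comp₂ (orderInvariant_apply le_rfl)
      fun x y => x * I.rv y
  simp only [hireAtProb, mul_assoc]
  rw [I.sum_noHireProb_mul s j.2.le hinv]
  exact mul_le_mul_of_nonneg_left (I.mean_le_sum_roundProb_mul s j) (meanNoHireProb_nonneg _ _ _)

end Instance

/-! ## Distribution of the signals -/

/-- Total probability of an adapted signal process: the last signal enters no earlier factor, so its
two values sum out. -/
theorem sum_prod_signal_eq_one {n : ℕ} (f : Fin n → (Fin n → Bool) → ℝ)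
    (hf : ∀ t σ σ', (∀ i < t, σ i = σ' i) → f t σ = f t σ') :
    ∑ σ : Fin n → Bool, ∏ t, (if σ t then f t σ else 1 - f t σ) = 1 := by
  induction n with
  | zero => simp
  | succ n ih =>
    let e := Fin.snocEquiv fun _ : Fin (n + 1) => Bool
    -- No factor looks at the last signal, so `true` can serve as its dummy value.
    have hcast : ∀ (b : Bool) (τ : Fin n → Bool) (t : Fin n), f t.castSucc (e (b, τ)) =
        f t.castSucc (e (true, τ)) := fun b τ t => hf _ _ _ fun i hi => by
      obtain ⟨k, rfl⟩ := Fin.exists_castSucc_eq.2 (Fin.ne_last_of_lt hi)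
      simp [e]
    have hlast : ∀ (b : Bool) (τ : Fin n → Bool), f (Fin.last n) (e (b, τ)) =
        f (Fin.last n) (e (true, τ)) := fun b τ => hf _ _ _ fun i hi => by
      obtain ⟨k, rfl⟩ := Fin.exists_castSucc_eq.2 hi.ne
      simp [e]
    have h := ih (fun t τ => f t.castSucc (e (true, τ))) fun t τ τ' h => hf _ _ _ fun i hi => by
      obtain ⟨k, rfl⟩ := Fin.exists_castSucc_eq.2 (Fin.ne_last_of_lt hi)
      simp [e, h k (by simpa using hi)]
    rw [← e.sum_comp, Fintype.sum_prod_type_right]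
    refine Eq.trans ?_ h
    refine Finset.sum_congr rfl fun τ _ => ?_
    have hv : ∀ (b : Bool), ∏ t, (if e (b, τ) t then f t (e (b, τ)) else 1 - f t (e (b, τ))) =
        (∏ t : Fin n, if τ t then f t.castSucc (e (true, τ)) else
          1 - f t.castSucc (e (true, τ))) *
        if b then f (Fin.last n) (e (true, τ)) else 1 - f (Fin.last n) (e (true, τ)) := by
      intro b
      rw [Fin.prod_univ_castSucc, hlast]
      simp only [hcast b]
      simp [e]
    rw [Fintype.sum_bool, hv, hv]
    simp only [if_true, Bool.false_eq_true, if_false]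
    ring

namespace Strategy
variable {n : ℕ} (φ : Strategy n) (I : Instance n)

theorem sum_signalProb (θ : Fin n → ℝ × ℝ) : ∑ σ, φ.signalProb θ σ = 1 :=
  sum_prod_signal_eq_one (fun t => φ.hireProb t θ)
    fun t σ σ' h => φ.adapted t θ θ σ σ' (fun _ _ => rfl) h

theorem signalProb_nonneg (θ : Fin n → ℝ × ℝ) (σ : Fin n → Bool) : 0 ≤ φ.signalProb θ σ :=
  Finset.prod_nonneg fun t _ => by
    split_ifs
    exacts [φ.nonneg _ _ _, sub_nonneg.2 (φ.le_one _ _ _)]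

theorem expect_mono {f g : Equiv.Perm (Fin n) → (Fin n → Bool) → ℝ} (h : ∀ π σ, f π σ ≤ g π σ) :
    φ.expect I f ≤ φ.expect I g :=
  div_le_div_of_nonneg_right (Finset.sum_le_sum fun _ _ => Finset.sum_le_sum fun _ _ =>
    mul_le_mul_of_nonneg_left (h _ _) (φ.signalProb_nonneg _ _)) (Nat.cast_nonneg _)

theorem expect_add (f g : Equiv.Perm (Fin n) → (Fin n → Bool) → ℝ) :
    φ.expect I (fun π σ => f π σ + g π σ) = φ.expect I f + φ.expect I g := by
  simp only [expect, mul_add, Finset.sum_add_distrib, add_div]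

theorem expect_mul_const (f : Equiv.Perm (Fin n) → (Fin n → Bool) → ℝ) (a : ℝ) :
    φ.expect I (fun π σ => f π σ * a) = φ.expect I f * a := by
  simp only [expect, ← mul_assoc, ← Finset.sum_mul]
  ring

theorem expect_order (f : Equiv.Perm (Fin n) → ℝ) :
    φ.expect I (fun π _ => f π) = (∑ π, f π) / n.factorial := by
  simp only [expect, ← Finset.sum_mul, sum_signalProb, one_mul]

theorem expect_const (a : ℝ) : φ.expect I (fun _ _ => a) = a := by
  rw [expect_order, Finset.sum_const, Finset.card_univ, Fintype.card_perm, Fintype.card_fin,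
    nsmul_eq_mul, mul_div_cancel_left₀]
  exact_mod_cast n.factorial_ne_zero

end Strategy

/-- The signals with a single HIRE, in round `j`. -/
def singleHire {n : ℕ} (j : Fin n) : Fin n → Bool := fun i => decide (i = j)

theorem singleHire_eq_true {n : ℕ} {i j : Fin n} : singleHire j i = true ↔ i = j := by
  simp [singleHire]

theorem singleHire_eq_false {n : ℕ} {i j : Fin n} : singleHire j i = false ↔ i ≠ j := by
  simp [singleHire]

theorem singleHire_injective {n : ℕ} : Function.Injective (singleHire (n := n)) := fun i j h => by
  have := congrFun h i
  rwa [singleHire_eq_true.2 rfl, eq_comm, singleHire_eq_true] at this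

section GrowingPareto
variable {n : ℕ} (I : Instance n) (s : ℕ)

theorem growingPareto_hireProb (π : Equiv.Perm (Fin n)) (t : Fin n) {σ : Fin n → Bool}
    (hσ : ∀ i < t, σ i = false) :
    (growingPareto n s).hireProb t (I.states π) σ = I.roundProb s π t := by
  classical
  have h : ¬ ∃ i < t, σ i = true := fun ⟨i, hi, h⟩ => by simp [hσ i hi] at h
  have ha : arrived (I.states π) t = (front π (t + 1)).image I.pair := by
    rw [front_eq_map, Finset.map_eq_image, Finset.image_image]
    unfold arrived
    congr
  simp only [growingPareto, if_neg h, Instance.roundProb, Instance.returnProb, ha]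
  rfl

theorem growingPareto_signalProb_singleHire (π : Equiv.Perm (Fin n)) (j : Fin n) :
    (growingPareto n s).signalProb (I.states π) (singleHire j) = I.hireAtProb s π j := by
  have h : ∀ t, (if singleHire j t then
      (growingPareto n s).hireProb t (I.states π) (singleHire j) else
      1 - (growingPareto n s).hireProb t (I.states π) (singleHire j)) =
      (if (t : ℕ) < j then 1 - I.roundProb s π t else 1) *
        if t = j then I.roundProb s π t else 1 := by
    intro t
    rcases lt_trichotomy t j with htj | htj | htj
    · have h1 : singleHire j t = false := singleHire_eq_false.2 htj.ne
      rw [growingPareto_hireProb I s π t fun i hi => singleHire_eq_false.2 (hi.trans htj).ne,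
        if_pos (Fin.lt_def.1 htj), if_neg htj.ne, h1]
      simp
    · subst htj
      rw [growingPareto_hireProb I s π t fun i hi => singleHire_eq_false.2 hi.ne,
        if_pos (singleHire_eq_true.2 rfl)]
      simp
    · have h1 : singleHire j t = false := singleHire_eq_false.2 htj.ne'
      have h2 : ∃ i < t, singleHire j i = true := ⟨j, htj, singleHire_eq_true.2 rfl⟩
      rw [if_neg (Fin.lt_def.1 htj).not_gt, if_neg htj.ne', h1]
      simp [growingPareto, h2]
  rw [Strategy.signalProb, Finset.prod_congr rfl fun t _ => h t, Finset.prod_mul_distrib,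
    Finset.prod_ite_eq' , if_pos (Finset.mem_univ j), ← Finset.prod_filter]
  rfl

theorem growingPareto_signalProb_eq_zero (hn : 0 < n) (π : Equiv.Perm (Fin n)) {σ : Fin n → Bool}
    (hσ : ∀ j, σ ≠ singleHire j) : (growingPareto n s).signalProb (I.states π) σ = 0 := by
  classical
  by_cases hex : ∃ j, σ j = true
  -- With `j` the first HIRE, any deviation from `singleHire j` is a second HIRE, which has
  -- probability 0. In the other case the forced HIRE of the last round is missing.
  · obtain ⟨j, hj, hmin⟩ := WellFounded.has_min (wellFounded_lt (α := Fin n)) {j | σ j = true} hex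
    have hj' : σ j = true := hj
    obtain ⟨t, ht⟩ := Function.ne_iff.1 (hσ j)
    have htj : t ≠ j := fun h => ht (by rw [h, hj', singleHire_eq_true.2 rfl])
    have hσt : σ t = true := by
      rw [singleHire_eq_false.2 htj] at ht
      simpa using ht
    have hlt : j < t := lt_of_le_of_ne (not_lt.1 (hmin t hσt)) htj.symm
    have h2 : ∃ i < t, σ i = true := ⟨j, hlt, hj'⟩
    refine Finset.prod_eq_zero (Finset.mem_univ t) ?_
    rw [if_pos hσt]
    exact if_pos h2
  · push Not at hex
    simp only [Bool.not_eq_true] at hex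
    have hlast : (n - 1) + 1 = n := by omega
    refine Finset.prod_eq_zero (Finset.mem_univ ⟨n - 1, by omega⟩) ?_
    rw [hex, growingPareto_hireProb I s π _ fun i _ => hex i, Instance.roundProb, if_pos hlast]
    simp

theorem growingPareto_sum_signal (hn : 0 < n) (π : Equiv.Perm (Fin n))
    (f : (Fin n → Bool) → ℝ) :
    ∑ σ, (growingPareto n s).signalProb (I.states π) σ * f σ =
      ∑ j, I.hireAtProb s π j * f (singleHire j) := by
  classical
  simp only [← growingPareto_signalProb_singleHire]
  rw [← Finset.sum_image (s := Finset.univ) (g := singleHire)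
    (f := fun σ => (growingPareto n s).signalProb (I.states π) σ * f σ)
    fun _ _ _ _ h => singleHire_injective h]
  refine (Finset.sum_subset (Finset.subset_univ _) fun σ _ hσ => ?_).symm
  rw [growingPareto_signalProb_eq_zero I s hn π fun j h => hσ
    (Finset.mem_image.2 ⟨j, Finset.mem_univ _, h.symm⟩), zero_mul]

theorem growingPareto_expect (hn : 0 < n) (f : Equiv.Perm (Fin n) → (Fin n → Bool) → ℝ) :
    (growingPareto n s).expect I f =
      (∑ j, ∑ π, I.hireAtProb s π j * f π (singleHire j)) / n.factorial := by
  simp only [Strategy.expect, growingPareto_sum_signal I s hn]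
  rw [Finset.sum_comm]

theorem sum_hireAtProb (hn : 0 < n) (π : Equiv.Perm (Fin n)) :
    ∑ j, I.hireAtProb s π j = 1 := by
  have := growingPareto_sum_signal I s hn π fun _ => 1
  simp only [mul_one, Strategy.sum_signalProb] at this
  exact this.symm

/-! ## Persuasiveness -/

/-- Expected receiver value of the candidate of round `i`, on the event that round `j` has the first
HIRE signal (times `n!`). -/
noncomputable def hireValue (j i : Fin n) : ℝ := ∑ π, I.hireAtProb s π j * I.rv (π i)

/-- Probability that round `j` has the first HIRE signal (times `n!`). -/
noncomputable def hireWeight (j : Fin n) : ℝ := ∑ π, I.hireAtProb s π j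

theorem hireWeight_eq (j : Fin n) :
    hireWeight I s j = meanNoHireProb n s j * meanRoundProb n s j * n.factorial := by
  have := I.sum_hireAtProb_mul s j (orderInvariant_const _ 1)
  simp only [mul_one] at this
  rw [hireWeight, this, Finset.sum_const, Finset.card_univ, Fintype.card_perm, Fintype.card_fin,
    nsmul_eq_mul, mul_one]

/-- Arrivals after the first HIRE are independent of it. -/
theorem hireValue_of_lt {j i : Fin n} (h : j < i) :
    hireValue I s j i = hireWeight I s j * mean Finset.univ I.rv := by
  have := I.sum_hireAtProb_mul s j (g := fun π => I.rv (π i))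
    ((orderInvariant_apply (Nat.succ_le_of_lt h)).comp₂ (orderInvariant_const _ ())
      fun x _ => I.rv x)
  rw [hireValue, this, hireWeight_eq, sum_apply_eq_mean]
  ring

theorem le_hireValue_self (j : Fin n) :
    hireWeight I s j * mean Finset.univ I.rv ≤ hireValue I s j j := by
  have := I.le_sum_hireAtProb_mul_self s j
  rw [sum_apply_eq_mean, ← mul_assoc, ← hireWeight_eq I s j] at this
  exact this

theorem hireValue_nonneg (j i : Fin n) : 0 ≤ hireValue I s j i :=
  Finset.sum_nonneg fun π _ => mul_nonneg (I.hireAtProb_nonneg s π j) (I.rv_nonneg _)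

theorem hireValue_le_self {j i : Fin n} (h : j ≤ i) : hireValue I s j i ≤ hireValue I s j j := by
  rcases h.eq_or_lt with rfl | h
  · exact le_rfl
  · rw [hireValue_of_lt I s h]
    exact le_hireValue_self I s j

theorem sum_eq_sum_Iio_add_add_sum_Ioi (f : Fin n → ℝ) (i : Fin n) :
    ∑ j, f j = ∑ j ∈ Finset.Iio i, f j + f i + ∑ j ∈ Finset.Ioi i, f j := by
  have h : (Finset.univ : Finset (Fin n)) = Finset.Iio i ∪ ({i} ∪ Finset.Ioi i) := by
    ext j
    simp only [Finset.mem_univ, Finset.mem_union, Finset.mem_Iio, Finset.mem_singleton,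
      Finset.mem_Ioi, true_iff]
    exact lt_trichotomy j i
  rw [h, Finset.sum_union, Finset.sum_union, Finset.sum_singleton, add_assoc]
  · simp
  · rw [Finset.disjoint_left]
    intro j hj
    simp only [Finset.mem_Iio, Finset.mem_union, Finset.mem_singleton, Finset.mem_Ioi] at hj ⊢
    rintro (rfl | h)
    · exact lt_irrefl _ hj
    · exact lt_asymm h hj

/-- Split the total value of round `i` by the round `j` of the first HIRE. The part `j < i` is
average and the part `j = i` at least average, so the part `j > i` is at most average, whereas
obedience earns at least the average there. -/
theorem sum_hireValue_le (i : Fin n) :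
    ∑ j ∈ Finset.Ioi i, hireValue I s j i ≤ ∑ j ∈ Finset.Ioi i, hireValue I s j j := by
  have hn := Fin.pos i
  have h1 : ∑ j, hireValue I s j i = n.factorial * mean Finset.univ I.rv := by
    simp only [hireValue]
    rw [Finset.sum_comm, ← sum_apply_eq_mean I.rv i]
    simp only [← Finset.sum_mul, sum_hireAtProb I s hn, one_mul]
  have h2 : ∑ j, hireWeight I s j = n.factorial := by
    simp only [hireWeight]
    rw [Finset.sum_comm]
    simp only [sum_hireAtProb I s hn]
    rw [Finset.sum_const, Finset.card_univ, Fintype.card_perm, Fintype.card_fin, nsmul_eq_mul,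
      mul_one]
  rw [sum_eq_sum_Iio_add_add_sum_Ioi _ i] at h1 h2
  have h3 : ∑ j ∈ Finset.Iio i, hireValue I s j i =
      (∑ j ∈ Finset.Iio i, hireWeight I s j) * mean Finset.univ I.rv := by
    rw [Finset.sum_mul]
    exact Finset.sum_congr rfl fun j hj => hireValue_of_lt I s (Finset.mem_Iio.1 hj)
  have h4 : (∑ j ∈ Finset.Ioi i, hireWeight I s j) * mean Finset.univ I.rv ≤
      ∑ j ∈ Finset.Ioi i, hireValue I s j j := by
    rw [Finset.sum_mul]
    exact Finset.sum_le_sum fun j _ => le_hireValue_self I s j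
  have h5 := le_hireValue_self I s i
  rw [← h2] at h1
  nlinarith

theorem DecisionRule.HiresAt.unique {ψ : DecisionRule n} {t i i' : Fin n} {σ : Fin n → Bool}
    (h : ψ.HiresAt t σ i) (h' : ψ.HiresAt t σ i') : i = i' := by
  rcases lt_trichotomy i i' with hlt | h0 | hlt
  · exact absurd h.2.1 (h'.2.2 i h.1 hlt)
  · exact h0
  · exact absurd h'.2.1 (h.2.2 i' h'.1 hlt)

theorem DecisionRule.HiresAt.payoff_eq {ψ : DecisionRule n} {t i : Fin n} {σ : Fin n → Bool}
    (h : ψ.HiresAt t σ i) (π : Equiv.Perm (Fin n)) : ψ.payoff I t π σ = I.rv (π i) := by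
  classical
  rw [payoff, Finset.sum_eq_single i fun j _ hj => if_neg fun h' => hj (h'.unique h),
    if_pos h]
  simp

theorem DecisionRule.payoff_eq_zero {ψ : DecisionRule n} {t : Fin n} {σ : Fin n → Bool}
    (h : ∀ i, ¬ ψ.HiresAt t σ i) (π : Equiv.Perm (Fin n)) : ψ.payoff I t π σ = 0 := by
  classical
  exact Finset.sum_eq_zero fun i _ => if_neg (h i)

theorem DecisionRule.HiresAt.congr {ψ : DecisionRule n} {t i : Fin n} {σ σ' : Fin n → Bool}
    (h : ψ.HiresAt t σ i) (hσ : ∀ k ≤ i, σ k = σ' k) : ψ.HiresAt t σ' i :=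
  ⟨h.1, (ψ.adapted i σ σ' hσ).1 h.2.1, fun j htj hji hj => h.2.2 j htj hji
    ((ψ.adapted j σ σ' fun k hk => hσ k (hk.trans hji.le)).2 hj)⟩

theorem obedient_hiresAt {t j : Fin n} (h : t ≤ j) :
    (DecisionRule.obedient n).HiresAt t (singleHire j) j :=
  ⟨h, singleHire_eq_true.2 rfl, fun _ _ hi h' => hi.ne (singleHire_eq_true.1 h')⟩

/-- When the first HIRE comes in round `j`, a decision rule that hires in round `j` or later is not
better than obedience. -/
theorem sum_hireAtProb_payoff_le (ψ : DecisionRule n) {t j : Fin n}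
    (h : ∀ i, ψ.HiresAt t (singleHire j) i → j ≤ i) :
    ∑ π, I.hireAtProb s π j * ψ.payoff I t π (singleHire j) ≤ hireValue I s j j := by
  by_cases hex : ∃ i, ψ.HiresAt t (singleHire j) i
  · obtain ⟨i, hi⟩ := hex
    simp only [hi.payoff_eq]
    exact hireValue_le_self I s (h i hi)
  · push Not at hex
    simp only [DecisionRule.payoff_eq_zero I hex, mul_zero, Finset.sum_const_zero]
    exact hireValue_nonneg I s j j

/-- A history ending in HIRE fixes the round of hiring; a history of NOTs in the rounds up to `t`
says only that this round comes after `t`. -/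
theorem growingPareto_persuasive : (growingPareto n s).Persuasive I := by
  classical
  intro t h hh ψ
  have hn := Fin.pos t
  rw [growingPareto_expect I s hn, growingPareto_expect I s hn]
  refine div_le_div_of_nonneg_right ?_ (Nat.cast_nonneg _)
  have hite : ∀ (ψ : DecisionRule n) (j : Fin n), (∑ π, I.hireAtProb s π j *
      if ∀ i ≤ t, singleHire j i = h i then ψ.payoff I t π (singleHire j) else 0) =
      if ∀ i ≤ t, singleHire j i = h i then
        ∑ π, I.hireAtProb s π j * ψ.payoff I t π (singleHire j) else 0 := by
    intro ψ j
    split_ifs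
    · rfl
    · simp
  have hob : ∀ j, t ≤ j → ∑ π, I.hireAtProb s π j *
      (DecisionRule.obedient n).payoff I t π (singleHire j) = hireValue I s j j := by
    intro j hj
    simp only [(obedient_hiresAt hj).payoff_eq]
    rfl
  simp only [hite]
  cases ht : h t with
  | true =>
    have hmatch : ∀ j, (∀ i ≤ t, singleHire j i = h i) → t = j := fun j hj => by
      have := hj t le_rfl
      rw [ht] at this
      exact singleHire_eq_true.1 this
    refine Finset.sum_le_sum fun j _ => ?_
    split_ifs with hj
    · obtain rfl := hmatch j hj
      rw [hob t le_rfl]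
      exact sum_hireAtProb_payoff_le I s ψ fun i hi => hi.1
    · exact le_rfl
  | false =>
    have hmatch : ∀ j, (∀ i ≤ t, singleHire j i = h i) ↔ t < j := by
      refine fun j => ⟨fun hj => ?_, fun hj i hi => ?_⟩
      · by_contra! hlt
        have h1 := hj j hlt
        rw [singleHire_eq_true.2 rfl] at h1
        rcases hlt.eq_or_lt with rfl | hlt
        · simp [ht] at h1
        · simp [hh j hlt] at h1
      · rw [singleHire_eq_false.2 (hi.trans_lt hj).ne]
        rcases hi.eq_or_lt with rfl | hi
        · exact ht.symm
        · exact (hh i hi).symm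
    simp only [hmatch, ← Finset.sum_filter, Finset.filter_lt_eq_Ioi]
    rw [Finset.sum_congr rfl fun j hj => hob j (Finset.mem_Ioi.1 hj).le]
    have hagree : ∀ {i j : Fin n}, i < j → ∀ k ≤ i, singleHire j k = (fun _ => false) k :=
      fun hij k hk => singleHire_eq_false.2 (hk.trans_lt hij).ne
    -- Before HIRE a decision rule sees only NOTs, so its play there is fixed by the round `i`, if
    -- any, in which it hires on constant NOT.
    by_cases hex : ∃ i, ψ.HiresAt t (fun _ => false) i
    · obtain ⟨i, hi⟩ := hex
      -- If HIRE comes after `i`, the rule takes the candidate of round `i`; otherwise it cannot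
      -- hire before HIRE, and obedience is at least as good.
      have hle : ∀ j ∈ Finset.Ioi t, ∑ π, I.hireAtProb s π j * ψ.payoff I t π (singleHire j) ≤
          hireValue I s j j + if i < j then hireValue I s j i - hireValue I s j j else 0 := by
        intro j _
        split_ifs with hij
        · simp only [(hi.congr fun k hk => (hagree hij k hk).symm).payoff_eq]
          rw [add_sub_cancel]
          rfl
        · rw [add_zero]
          refine sum_hireAtProb_payoff_le I s ψ fun i' hi' => ?_
          by_contra! hlt
          have := (hi'.congr (hagree hlt)).unique hi
          exact hij (this ▸ hlt)
      refine (Finset.sum_le_sum hle).trans ?_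
      have hf : (Finset.Ioi t).filter (fun j => i < j) = Finset.Ioi i := by
        ext j
        simp only [Finset.mem_filter, Finset.mem_Ioi]
        exact ⟨fun h => h.2, fun h => ⟨hi.1.trans_lt h, h⟩⟩
      rw [Finset.sum_add_distrib, ← Finset.sum_filter, hf, Finset.sum_sub_distrib]
      linarith [sum_hireValue_le I s i]
    · push Not at hex
      refine Finset.sum_le_sum fun j _ => sum_hireAtProb_payoff_le I s ψ fun i hi => ?_
      by_contra! hlt
      exact hex i (hi.congr (hagree hlt))

end GrowingPareto

/-! ## The favorite's hiring probability on random subsets -/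

/-- The inequality behind deleting a random candidate: `T` is the set without `b` and `c`, `y` the
receiver's loss relative to `b` in units of the loss of `c` (so `y c = 1` and `y b = 0`), and `g`
the probability of `c` after deleting `b`. If `S < k + 1`, where `k = T.card`, no minimum on the
right is capped and the claim is linear in `S`. Otherwise `g = 1` and it suffices that the deficits
of the other terms sum to at most 1. -/
theorem mul_min_le_sum_min_add {ι : Type*} {T : Finset ι} {y : ι → ℝ} (hy : ∀ i ∈ T, 0 ≤ y i)
    {S g : ℝ} (hS : S = ∑ i ∈ T, y i + 1) (hg : 1 / ((T.card : ℝ) + 1) ≤ g)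
    (hg1 : (T.card : ℝ) + 1 ≤ S → g = 1) :
    (T.card : ℝ) * min 1 (S / (T.card + 2)) ≤
      ∑ i ∈ T, min 1 ((S - y i) / (T.card + 1)) + g := by
  classical
  set k : ℝ := (T.card : ℝ) with hk
  have hk0 : 0 ≤ k := Nat.cast_nonneg _
  have hk1 : 0 < k + 1 := by linarith
  have hk2 : 0 < k + 2 := by linarith
  rcases le_or_gt (k + 1) S with h | h
  · rw [hg1 h]
    have hmin : k * min 1 (S / (k + 2)) ≤ k * 1 :=
      mul_le_mul_of_nonneg_left (min_le_left _ _) hk0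
    suffices hs : ∑ i ∈ T, (1 - min 1 ((S - y i) / (k + 1))) ≤ 1 by
      rw [Finset.sum_sub_distrib, Finset.sum_const, nsmul_eq_mul, ← hk] at hs
      linarith
    have hterm : ∀ i ∈ T, 1 - min 1 ((S - y i) / (k + 1)) ≤ y i / (k + 1) := by
      intro i hi
      rcases min_choice 1 ((S - y i) / (k + 1)) with e | e <;> rw [e]
      · rw [sub_self]
        exact div_nonneg (hy i hi) hk1.le
      · rw [sub_le_iff_le_add, ← add_div, le_div_iff₀ hk1]
        linarith
    -- Bounding every deficit by `y i / (k + 1)` is too weak, as the sum of `y` may be large. If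
    -- some `a` has a positive deficit, its exact value and this bound for the others add up to `k /
    -- (k + 1)`.
    by_cases hex : ∃ i ∈ T, S - (k + 1) < y i
    · obtain ⟨a, ha, hlt⟩ := hex
      rw [← Finset.add_sum_erase _ _ ha] at hS ⊢
      have h1 : ∑ i ∈ T.erase a, (1 - min 1 ((S - y i) / (k + 1))) ≤
          (∑ i ∈ T.erase a, y i) / (k + 1) := by
        rw [Finset.sum_div]
        exact Finset.sum_le_sum fun i hi => hterm i (Finset.mem_of_mem_erase hi)
      have h2 : 1 - min 1 ((S - y a) / (k + 1)) = (k + 1 - (S - y a)) / (k + 1) := by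
        rw [min_eq_right ((div_le_one hk1).2 (by linarith)), sub_div (k + 1), div_self hk1.ne']
      rw [h2]
      refine (add_le_add_right h1 _).trans ?_
      rw [← add_div, div_le_one hk1]
      linarith
    · push Not at hex
      refine (Finset.sum_nonpos fun i hi => ?_).trans zero_le_one
      rw [min_eq_left ((one_le_div hk1).2 (by linarith [hex i hi])), sub_self]
  · have h1 : ∑ i ∈ T, min 1 ((S - y i) / (k + 1)) = (k * S - (S - 1)) / (k + 1) := by
      rw [Finset.sum_congr rfl fun i hi => min_eq_right
        ((div_le_one hk1).2 (by linarith [hy i hi])), ← Finset.sum_div, Finset.sum_sub_distrib,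
        Finset.sum_const, nsmul_eq_mul, ← hk, hS]
      ring
    have h2 : k * min 1 (S / (k + 2)) ≤ k * (S / (k + 2)) :=
      mul_le_mul_of_nonneg_left (min_le_right _ _) hk0
    have h3 : k * (S / (k + 2)) ≤ (k * S - (S - 1)) / (k + 1) + 1 / (k + 1) := by
      rw [← add_div, ← mul_div_assoc, div_le_div_iff₀ hk2 hk1]
      nlinarith
    linarith

section Favorite
variable {ι : Type*}

/-- With the losses normalized so that `c` has loss 1, the weight of `c` is the average loss capped
at 1. As long as `b` and `c` stay, deleting candidates does not change the individual losses. -/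
theorem favoriteProb_eq_min {A : Finset ι} {ρ : ι → ℝ} {c b : ι} (hc : c ∈ A) (h : ρ c < ρ b) :
    favoriteProb A ρ c b = min 1 ((∑ i ∈ A, (ρ b - ρ i) / (ρ b - ρ c)) / A.card) := by
  have hpos : (0 : ℝ) < A.card := by exact_mod_cast Finset.card_pos.2 ⟨c, hc⟩
  have hd : 0 < ρ b - ρ c := by linarith
  have he : (∑ i ∈ A, (ρ b - ρ i) / (ρ b - ρ c)) / A.card = (ρ b - mean A ρ) / (ρ b - ρ c) := by
    rw [← Finset.sum_div, Finset.sum_sub_distrib, Finset.sum_const, nsmul_eq_mul, mean]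
    field_simp
  rw [he, favoriteProb]
  split_ifs with hm
  · rw [min_eq_left ((one_le_div hd).2 (by linarith))]
  · rw [min_eq_right ((div_le_one hd).2 (by linarith))]

theorem one_div_card_le_favoriteProb {A : Finset ι} {ρ : ι → ℝ} {c b : ι} (hc : c ∈ A)
    (hb : ∀ j ∈ A, ρ j ≤ ρ b) : 1 / (A.card : ℝ) ≤ favoriteProb A ρ c b := by
  have hcard : (1 : ℝ) ≤ A.card := by exact_mod_cast Finset.card_pos.2 ⟨c, hc⟩
  have h1 : 1 / (A.card : ℝ) ≤ 1 := (div_le_one (by linarith)).2 hcard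
  rcases (hb c hc).eq_or_lt with h | h
  · rw [favoriteProb, if_pos (by rw [h]; exact mean_le_of_forall_le ⟨c, hc⟩ hb)]
    exact h1
  · rw [favoriteProb_eq_min hc h]
    have hd : 0 < ρ b - ρ c := by linarith
    refine le_min h1 (div_le_div_of_nonneg_right ?_ (by linarith))
    have := Finset.single_le_sum (f := fun i => (ρ b - ρ i) / (ρ b - ρ c))
      (fun i hi => div_nonneg (by linarith [hb i hi]) hd.le) hc
    simp only [div_self hd.ne'] at this
    exact this

end Favorite

namespace Instance
variable {n : ℕ} (I : Instance n)

theorem returnProb_favorite_mem {B : Finset (Fin n)} {c : Fin n} :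
    0 ≤ I.returnProb B c ∧ I.returnProb B c ≤ 1 := paretoReturnProb_mem _ _ _ _

/-- Removing a random candidate other than the sender's favorite `c` decreases the probability that
`c` is returned by a factor of at most `(m - 2) / (m - 1)`, where `m` is the number of candidates. -/
theorem returnProb_le_sum_erase {B : Finset (Fin n)} {c : Fin n} (hc : c ∈ B)
    (hcmax : ∀ j, I.sv j ≤ I.sv c) :
    ((B.card : ℝ) - 2) * I.returnProb B c ≤ ∑ x ∈ B.erase c, I.returnProb (B.erase x) c := by
  obtain ⟨b, hb, hbmax⟩ := B.exists_max_image I.rv ⟨c, hc⟩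
  have hmem := I.returnProb_favorite_mem (B := B) (c := c)
  by_cases hbc : b = c
  · subst hbc
    have hone : ∀ x ∈ B.erase b, I.returnProb (B.erase x) b = 1 := by
      intro x hx
      have hbx : b ∈ B.erase x := Finset.mem_erase.2 ⟨(Finset.ne_of_mem_erase hx).symm, hb⟩
      have hmax : ∀ j ∈ B.erase x, I.rv j ≤ I.rv b := fun j hj =>
        hbmax j (Finset.mem_of_mem_erase hj)
      rw [I.returnProb_favorite hbx (fun j _ => hcmax j) hbx hmax, favoriteProb,
        if_pos (mean_le_of_forall_le ⟨b, hbx⟩ hmax)]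
    have hcard : (1 : ℝ) ≤ B.card := by exact_mod_cast Finset.card_pos.2 ⟨b, hb⟩
    rw [Finset.sum_congr rfl hone, Finset.sum_const, Finset.card_erase_of_mem hb, nsmul_eq_mul,
      Nat.cast_sub (Finset.card_pos.2 ⟨b, hb⟩), Nat.cast_one]
    nlinarith
  · have hlt : I.rv c < I.rv b := (hbmax c hc).lt_of_ne fun h => hbc (I.rv_injective h).symm
    have hd : 0 < I.rv b - I.rv c := by linarith
    set y : Fin n → ℝ := fun i => (I.rv b - I.rv i) / (I.rv b - I.rv c) with hy
    have hyc : y c = 1 := div_self hd.ne'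
    have hyb : y b = 0 := by simp [hy]
    have hbe : b ∈ B.erase c := Finset.mem_erase.2 ⟨hbc, hb⟩
    set T := (B.erase c).erase b with hT
    have hcardc : (B.erase c).card = T.card + 1 := (Finset.card_erase_add_one hbe).symm
    have hcard : B.card = T.card + 2 := by
      rw [← Finset.card_erase_add_one hc, hcardc]
    have hcard' : ∀ x ∈ B, ((B.erase x).card : ℝ) = T.card + 1 := by
      intro x hx
      rw [Finset.card_erase_of_mem hx, hcard]
      push_cast [Nat.add_sub_assoc]
      ring
    have hS : ∑ i ∈ B, y i = ∑ i ∈ T, y i + 1 := by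
      rw [← Finset.add_sum_erase B y hc, ← Finset.add_sum_erase (B.erase c) y hbe, hyc, hyb]
      ring
    have hform : ∀ A : Finset (Fin n), A ⊆ B → c ∈ A → b ∈ A →
        I.returnProb A c = min 1 ((∑ i ∈ A, y i) / A.card) := fun A hA hcA hbA => by
      rw [I.returnProb_favorite hcA (fun j _ => hcmax j) hbA (fun j hj => hbmax j (hA hj)),
        favoriteProb_eq_min hcA hlt]
    have hcb : c ∈ B.erase b := Finset.mem_erase.2 ⟨Ne.symm hbc, hc⟩
    obtain ⟨b', hb', hbmax'⟩ := (B.erase b).exists_max_image I.rv ⟨c, hcb⟩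
    have hgb := I.returnProb_favorite hcb (fun j _ => hcmax j) hb' hbmax'
    -- Deleting `b` changes the receiver's favorite and thus the normalization. For that term two
    -- facts suffice: it is at least one over the number of remaining candidates, and it is 1 when
    -- `c` reaches their mean.
    have key := mul_min_le_sum_min_add (T := T) (y := y) (S := ∑ i ∈ B, y i)
      (g := I.returnProb (B.erase b) c)
      (fun i hi => div_nonneg (by
        linarith [hbmax i (Finset.mem_of_mem_erase (Finset.mem_of_mem_erase hi))]) hd.le) hS
      (by rw [hgb, ← hcard' b hb]; exact one_div_card_le_favoriteProb hcb hbmax')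
      (fun h => by
        rw [hgb, favoriteProb, if_pos]
        have hs := Finset.add_sum_erase B y hb
        rw [hyb, zero_add] at hs
        rw [← hs, ← Finset.sum_div, le_div_iff₀ hd, Finset.sum_sub_distrib, Finset.sum_const,
          nsmul_eq_mul, hcard' b hb] at h
        rw [mean, hcard' b hb, div_le_iff₀ (by positivity)]
        linarith)
    rw [← Finset.add_sum_erase (B.erase c) _ hbe, hform B subset_rfl hc hb, add_comm, hcard]
    have hcongr : ∀ x ∈ T, I.returnProb (B.erase x) c =
        min 1 ((∑ i ∈ B, y i - y x) / (T.card + 1)) := by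
      intro x hx
      have hxb := Finset.ne_of_mem_erase hx
      have hxc := Finset.ne_of_mem_erase (Finset.mem_of_mem_erase hx)
      have hxB := Finset.mem_of_mem_erase (Finset.mem_of_mem_erase hx)
      rw [hform _ (Finset.erase_subset _ _) (Finset.mem_erase.2 ⟨hxc.symm, hc⟩)
        (Finset.mem_erase.2 ⟨hxb.symm, hb⟩), hcard' x hxB, ← Finset.add_sum_erase B y hxB]
      ring_nf
    rw [Finset.sum_congr rfl hcongr]
    push_cast
    rw [add_sub_cancel_right]
    exact key

/-- Sum over all arrival orders of the probability that the Pareto procedure returns `c` when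
applied to the first `t` candidates. -/
noncomputable def frontProb (c : Fin n) (t : ℕ) : ℝ :=
  ∑ π : Equiv.Perm (Fin n), if c ∈ front π t then I.returnProb (front π t) c else 0

theorem frontProb_succ_le {c : Fin n} (hcmax : ∀ j, I.sv j ≤ I.sv c) (j : Fin n) :
    ((j : ℝ) - 1) * I.frontProb c (j + 1) ≤ ((j : ℝ) + 1) * I.frontProb c j := by
  -- The first `j` candidates arise from the first `j + 1` by deleting a uniformly random one;
  -- deleting `c` itself contributes 0.
  have h := sum_apply_eq_sum_front j (K := fun π x => if c ∈ (front π (j + 1)).erase x then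
      I.returnProb ((front π (j + 1)).erase x) c else 0)
      ((orderInvariant_front le_rfl).comp₂ (orderInvariant_const _ ()) fun A _ x =>
        if c ∈ A.erase x then I.returnProb (A.erase x) c else 0)
  simp only [front_erase] at h
  rw [frontProb, frontProb, h, Finset.mul_sum]
  refine Finset.sum_le_sum fun π _ => ?_
  split_ifs with hc
  · have h1 := I.returnProb_le_sum_erase hc hcmax
    rw [card_front] at h1
    push_cast at h1
    rw [← Finset.add_sum_erase _ _ hc, if_neg (Finset.notMem_erase c _), zero_add,
      Finset.sum_congr rfl fun x hx => if_pos
        (Finset.mem_erase.2 ⟨(Finset.ne_of_mem_erase hx).symm, hc⟩)]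
    linarith
  · rw [mul_zero]
    refine Finset.sum_nonneg fun x _ => ?_
    split_ifs
    exacts [I.returnProb_nonneg _ _, le_rfl]

/-- Downward from `t = n`, the factors `(t - 1) / (t + 1)` of `frontProb_succ_le` telescope. -/
theorem le_frontProb {c : Fin n} (hcmax : ∀ j, I.sv j ≤ I.sv c) {t : ℕ} (ht1 : 1 ≤ t)
    (htn : t ≤ n) :
    (t : ℝ) * (t - 1) * (n.factorial * I.returnProb Finset.univ c) ≤
      (n : ℝ) * (n - 1) * I.frontProb c t := by
  induction htn using Nat.decreasingInduction with
  | self => simp [frontProb, front_eq_univ, Fintype.card_perm]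
  | of_succ t htn ih =>
    have h1 := ih (by omega)
    have h2 := I.frontProb_succ_le hcmax ⟨t, htn⟩
    simp only at h2
    have ht : (1 : ℝ) ≤ t := by exact_mod_cast ht1
    have hn : (1 : ℝ) ≤ n := by exact_mod_cast ht1.trans htn.le
    have ht0 : (0 : ℝ) < (t : ℝ) + 1 := by linarith
    push_cast at h1
    rw [← mul_le_mul_iff_right₀ ht0]
    have h3 := mul_le_mul_of_nonneg_left h1 (sub_nonneg.2 ht)
    have h4 := mul_le_mul_of_nonneg_left h2
      (mul_nonneg (zero_le_one.trans hn) (sub_nonneg.2 hn))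
    linarith

end Instance

/-! ## Success probability and benchmark -/

section Success
variable {n : ℕ} (I : Instance n)

theorem growingPareto_success_eq {s : ℕ} {c : Fin n} (hcmax : ∀ j, I.sv j ≤ I.sv c) :
    (growingPareto n s).success I =
      (∑ j, ∑ π, I.hireAtProb s π j * if π j = c then 1 else 0) / n.factorial := by
  rw [Strategy.success, growingPareto_expect I s (Fin.pos c)]
  congr! 7 with j _ π _
  constructor
  · rintro ⟨t, ⟨ht, -⟩, h⟩
    rw [← singleHire_eq_true.1 ht]
    exact I.sv_injective ((hcmax _).antisymm (h c))
  · intro h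
    exact ⟨j, ⟨singleHire_eq_true.2 rfl, fun i hi => singleHire_eq_false.2 hi.ne⟩,
      fun k => h ▸ hcmax k⟩

/-- The factors `s / j` for no earlier HIRE, `1 / (j + 1)` for the arrival of `c`, and `j (j + 1) /
(n (n - 1))` from `le_frontProb` multiply to a bound that does not depend on `j`. -/
theorem le_sum_hireAtProb_favorite {s : ℕ} (hs : 1 ≤ s) {c : Fin n}
    (hcmax : ∀ j, I.sv j ≤ I.sv c) {j : Fin n} (hsj : s ≤ j) (hj : (j : ℕ) + 1 < n) :
    (s : ℝ) / (n * (n - 1)) * I.returnProb Finset.univ c * n.factorial ≤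
      ∑ π, I.hireAtProb s π j * if π j = c then 1 else 0 := by
  have hinv : OrderInvariant j fun π => I.roundProb s π j * if π j = c then (1 : ℝ) else 0 :=
    (I.orderInvariant_roundProb s le_rfl).comp₂ (orderInvariant_apply le_rfl)
      fun x y => x * if y = c then 1 else 0
  have h := sum_apply_eq_sum_front j
    (K := fun π x => I.returnProb (front π (j + 1)) x * if x = c then 1 else 0)
    ((orderInvariant_front le_rfl).comp₂ (orderInvariant_const _ ())
      fun A _ x => I.returnProb A x * if x = c then 1 else 0)
  have hfront : ∑ π : Equiv.Perm (Fin n), ∑ x ∈ front π (j + 1),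
      (I.returnProb (front π (j + 1)) x * if x = c then 1 else 0) = I.frontProb c (j + 1) := by
    simp only [mul_ite, mul_one, mul_zero, Finset.sum_ite_eq', Instance.frontProb]
  have hround : ∀ π, I.roundProb s π j = I.returnProb (front π (j + 1)) (π j) := fun π => by
    rw [Instance.roundProb, if_neg (by omega), if_neg (by omega)]
  simp only [Instance.hireAtProb, mul_assoc]
  rw [I.sum_noHireProb_mul s j.2.le hinv, meanNoHireProb_eq hs hsj j.2]
  simp only [hround]
  rw [hfront] at h
  have hF := I.le_frontProb hcmax (t := j + 1) (by omega) hj.le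
  have hj0 : (0 : ℝ) < j := by
    have : 0 < (j : ℕ) := by omega
    exact_mod_cast this
  have hn1 : (1 : ℝ) < n := by
    have : 1 < n := by omega
    exact_mod_cast this
  have hn0 : 0 < (n : ℝ) * (n - 1) := mul_pos (by linarith) (by linarith)
  have hj1 : (0 : ℝ) < (j : ℝ) + 1 := by linarith
  push_cast at hF
  rw [← h, add_sub_cancel_right] at hF
  set X := ∑ π : Equiv.Perm (Fin n),
    I.returnProb (front π (j + 1)) (π j) * if π j = c then (1 : ℝ) else 0
  have hX : (j : ℝ) * (n.factorial * I.returnProb Finset.univ c) ≤ (n : ℝ) * (n - 1) * X := by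
    rw [← mul_le_mul_iff_right₀ hj1]
    linarith
  rw [div_mul_eq_mul_div, div_mul_eq_mul_div, div_le_div_iff₀ hn0 hj0]
  have := mul_le_mul_of_nonneg_left hX (Nat.cast_nonneg (α := ℝ) s)
  linarith

theorem growingPareto_success_nonneg (s : ℕ) : 0 ≤ (growingPareto n s).success I := by
  refine ((growingPareto n s).expect_const I 0).symm.le.trans ?_
  exact Strategy.expect_mono _ _ fun π σ => by split_ifs <;> norm_num

theorem le_growingPareto_success {s : ℕ} (hs : 1 ≤ s) (hsn : s + 1 ≤ n) {c : Fin n}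
    (hcmax : ∀ j, I.sv j ≤ I.sv c) :
    (s : ℝ) * (n - 1 - s) / (n * (n - 1)) * I.returnProb Finset.univ c ≤
      (growingPareto n s).success I := by
  have hfac : (0 : ℝ) < n.factorial := by exact_mod_cast n.factorial_pos
  rw [growingPareto_success_eq I hcmax, le_div_iff₀ hfac]
  -- The rounds after the sample except the last one, where HIRE is forced and the Pareto procedure
  -- is not used.
  let J : Finset (Fin n) := (Finset.Ico s (n - 1)).attachFin fun m hm => by
    rw [Finset.mem_Ico] at hm
    omega
  have hJ : (J.card : ℝ) = n - 1 - s := by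
    rw [Finset.card_attachFin, Nat.card_Ico, Nat.cast_sub (by omega), Nat.cast_sub (by omega),
      Nat.cast_one]
  calc (s : ℝ) * (n - 1 - s) / (n * (n - 1)) * I.returnProb Finset.univ c * n.factorial
      = ∑ _j ∈ J, (s : ℝ) / (n * (n - 1)) * I.returnProb Finset.univ c * n.factorial := by
        rw [Finset.sum_const, nsmul_eq_mul, hJ]
        ring
    _ ≤ ∑ j ∈ J, ∑ π, I.hireAtProb s π j * (if π j = c then 1 else 0) := by
        refine Finset.sum_le_sum fun j hj => ?_
        rw [Finset.mem_attachFin, Finset.mem_Ico] at hj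
        exact le_sum_hireAtProb_favorite I hs hcmax hj.1 (by omega)
    _ ≤ ∑ j, ∑ π, I.hireAtProb s π j * (if π j = c then 1 else 0) := by
        refine Finset.sum_le_sum_of_subset_of_nonneg (Finset.subset_univ _) fun j _ _ =>
          Finset.sum_nonneg fun π _ => mul_nonneg (I.hireAtProb_nonneg s π j) ?_
        split_ifs <;> norm_num

theorem Strategy.success_le_one (φ : Strategy n) : φ.success I ≤ 1 := by
  refine le_of_le_of_eq ?_ (φ.expect_const I 1)
  exact φ.expect_mono _ fun π σ => by split_ifs <;> norm_num

/-- A receiver who hires the first candidate gets the average value. -/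
theorem Strategy.Persuasive.mean_le {φ : Strategy n} (hφ : φ.Persuasive I) (hn : 0 < n) :
    mean Finset.univ I.rv ≤
      φ.expect I (fun π σ => (DecisionRule.obedient n).payoff I ⟨0, hn⟩ π σ) := by
  classical
  let ψ : DecisionRule n := ⟨fun _ _ => True, fun _ _ _ _ => Iff.rfl⟩
  have hψ : ∀ π σ, ψ.payoff I ⟨0, hn⟩ π σ = I.rv (π ⟨0, hn⟩) := fun π σ =>
    DecisionRule.HiresAt.payoff_eq I ⟨le_rfl, trivial, fun j h1 h2 _ => absurd h2 h1.not_gt⟩ π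
  -- Persuasiveness is conditional on the signal of the first round; adding its two cases gives the
  -- unconditional comparison.
  have hsplit : ∀ ψ' : DecisionRule n, φ.expect I (fun π σ => ψ'.payoff I ⟨0, hn⟩ π σ) =
      φ.expect I (fun π σ => if ∀ i ≤ (⟨0, hn⟩ : Fin n), σ i = (fun _ => true) i then
        ψ'.payoff I ⟨0, hn⟩ π σ else 0) +
      φ.expect I (fun π σ => if ∀ i ≤ (⟨0, hn⟩ : Fin n), σ i = (fun _ => false) i then
        ψ'.payoff I ⟨0, hn⟩ π σ else 0) := by
    intro ψ'
    rw [← Strategy.expect_add]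
    congr 1
    funext π σ
    have hle : ∀ b : Bool, (∀ i ≤ (⟨0, hn⟩ : Fin n), σ i = b) ↔ σ ⟨0, hn⟩ = b := by
      refine fun b => ⟨fun h => h _ le_rfl, fun h i hi => ?_⟩
      have : i = ⟨0, hn⟩ := Fin.ext (Nat.le_zero.1 (Fin.le_def.1 hi))
      rw [this, h]
    simp only [hle]
    cases σ ⟨0, hn⟩ <;> simp
  have hvac : ∀ h : Fin n → Bool, ∀ i < (⟨0, hn⟩ : Fin n), h i = false := fun h i hi =>
    absurd (Fin.lt_def.1 hi) (Nat.not_lt_zero _)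
  have h1 := hφ ⟨0, hn⟩ (fun _ => true) (hvac _) ψ
  have h2 := hφ ⟨0, hn⟩ (fun _ => false) (hvac _) ψ
  have h3 := add_le_add h1 h2
  rw [← hsplit, ← hsplit] at h3
  simp only [hψ] at h3
  rwa [φ.expect_order I fun π => I.rv (π ⟨0, hn⟩), sum_apply_eq_mean,
    mul_div_cancel_left₀ _ (by exact_mod_cast n.factorial_ne_zero)] at h3

open Classical in
-- Success yields exactly the value of `c`; failure, including hiring nobody, yields at most that of
-- `b`.
theorem obedient_payoff_le {c b : Fin n} (hcmax : ∀ j, I.sv j ≤ I.sv c)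
    (hbmax : ∀ j, I.rv j ≤ I.rv b) (hn : 0 < n) (π : Equiv.Perm (Fin n)) (σ : Fin n → Bool) :
    (DecisionRule.obedient n).payoff I ⟨0, hn⟩ π σ ≤
      (if ∃ t, (σ t = true ∧ ∀ j < t, σ j = false) ∧ ∀ k, I.sv k ≤ I.sv (π t) then 1 else 0) *
        (I.rv c - I.rv b) + I.rv b := by
  split_ifs with h
  · obtain ⟨t, ⟨ht, htmin⟩, hmax⟩ := h
    have hH : (DecisionRule.obedient n).HiresAt ⟨0, hn⟩ σ t :=
      ⟨Fin.le_def.2 (Nat.zero_le _), ht, fun j _ hj h' => by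
        have h'' : σ j = true := h'
        rw [htmin j hj] at h''
        exact Bool.false_ne_true h''⟩
    have hc : π t = c := I.sv_injective ((hcmax _).antisymm (hmax c))
    rw [hH.payoff_eq, hc]
    linarith
  · rw [zero_mul, zero_add]
    by_cases hex : ∃ i, (DecisionRule.obedient n).HiresAt ⟨0, hn⟩ σ i
    · obtain ⟨i, hi⟩ := hex
      rw [hi.payoff_eq]
      exact hbmax _
    · push Not at hex
      rw [DecisionRule.payoff_eq_zero I hex]
      exact I.rv_nonneg b

theorem Strategy.Persuasive.success_le {φ : Strategy n} (hφ : φ.Persuasive I) {c : Fin n}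
    (hcmax : ∀ j, I.sv j ≤ I.sv c) : φ.success I ≤ I.returnProb Finset.univ c := by
  obtain ⟨b, hb, hbmax⟩ := Finset.univ.exists_max_image I.rv ⟨c, Finset.mem_univ c⟩
  rw [I.returnProb_favorite (Finset.mem_univ c) (fun j _ => hcmax j) hb hbmax, favoriteProb]
  split_ifs with hm
  · exact φ.success_le_one I
  · have hn := Fin.pos c
    have hmb := mean_le_of_forall_le ⟨c, Finset.mem_univ c⟩ hbmax
    have h := (hφ.mean_le I hn).trans (φ.expect_mono I
      (obedient_payoff_le I hcmax (fun j => hbmax j (Finset.mem_univ j)) hn))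
    rw [Strategy.expect_add, Strategy.expect_mul_const, Strategy.expect_const] at h
    change _ ≤ φ.success I * _ + _ at h
    rw [le_div_iff₀ (by linarith)]
    linarith

theorem benchmarkSuccess_le {c : Fin n} (hcmax : ∀ j, I.sv j ≤ I.sv c) :
    benchmarkSuccess I ≤ I.returnProb Finset.univ c :=
  Real.sSup_le (by rintro _ ⟨φ, hφ, rfl⟩; exact hφ.success_le I hcmax) (I.returnProb_nonneg _ _)

end Success

/-! ### The limit of the guaranteed factor and the conclusion -/

theorem tendsto_half_mul_half :
    Filter.Tendsto (fun n : ℕ => ((n / 2 : ℕ) : ℝ) * (n - 1 - (n / 2 : ℕ)) / (n * (n - 1)))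
      Filter.atTop (nhds (1 / 4)) := by
  have h1 : Filter.Tendsto (fun n : ℕ => ((n / 2 : ℕ) : ℝ) / n) Filter.atTop (nhds (1 / 2)) := by
    have := (tendsto_nat_floor_mul_div_atTop (R := ℝ) (a := 1 / 2) (by norm_num)).comp
      tendsto_natCast_atTop_atTop
    refine this.congr fun n => ?_
    have : ⌊(1 / 2 : ℝ) * n⌋₊ = n / 2 := by
      rw [← Nat.floor_div_eq_div (K := ℝ)]
      congr 1
      push_cast
      ring
    simp only [Function.comp_apply, this]
  have h2 : Filter.Tendsto (fun n : ℕ => (1 : ℝ) / n) Filter.atTop (nhds 0) :=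
    tendsto_one_div_atTop_nhds_zero_nat
  have h3 := (h1.mul ((h2.const_sub 1).sub h1)).div (h2.const_sub 1) (by norm_num)
  have h4 : (1 / 2 * (1 - 0 - 1 / 2) / (1 - 0) : ℝ) = 1 / 4 := by norm_num
  rw [h4] at h3
  refine h3.congr' ?_
  filter_upwards [Filter.eventually_gt_atTop 1] with n hn
  have hn1 : (1 : ℝ) < n := by exact_mod_cast hn
  have hn0 : (n : ℝ) ≠ 0 := by linarith
  have hn2 : (n : ℝ) - 1 ≠ 0 := by linarith
  have e : 1 - 1 / (n : ℝ) = (n - 1) / n := by field_simp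
  simp only [Pi.div_apply]
  rw [e]
  field_simp

end OnlinePersuasion

theorem mainTheorem3 :
    (∀ (n : ℕ) (I : OnlinePersuasion.Instance n),
      (OnlinePersuasion.growingPareto n (n / 2)).Persuasive I) ∧
    ∃ ε : ℕ → ℝ, Filter.Tendsto ε Filter.atTop (nhds 0) ∧
      ∀ (n : ℕ) (I : OnlinePersuasion.Instance n),
        (1 / 4 - ε n) * OnlinePersuasion.benchmarkSuccess I ≤
          (OnlinePersuasion.growingPareto n (n / 2)).success I := by
  -- `ε n` is chosen so that `1 / 4 - ε n` is the factor proved for `s = n / 2`. For `n < 2` this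
  -- factor is 0 because `n / 2 = 0`, so non-negativity of the success probability is enough.
  refine ⟨fun n I => OnlinePersuasion.growingPareto_persuasive I _,
    fun n => 1 / 4 - ((n / 2 : ℕ) : ℝ) * (n - 1 - (n / 2 : ℕ)) / (n * (n - 1)), ?_, ?_⟩
  · have := OnlinePersuasion.tendsto_half_mul_half.const_sub (1 / 4)
    rwa [sub_self] at this
  · intro n I
    rw [sub_sub_cancel]
    by_cases hn : n < 2
    · have h0 : n / 2 = 0 := by omega
      rw [h0]
      simpa using OnlinePersuasion.growingPareto_success_nonneg I 0
    · obtain ⟨c, -, hc⟩ := Finset.univ.exists_max_image I.sv ⟨⟨0, by omega⟩, Finset.mem_univ _⟩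
      have hcmax : ∀ j, I.sv j ≤ I.sv c := fun j => hc j (Finset.mem_univ j)
      have hle : n / 2 + 1 ≤ n := by omega
      have hle' : ((n / 2 : ℕ) : ℝ) + 1 ≤ n := by exact_mod_cast hle
      have hn' : (0 : ℝ) ≤ ((n / 2 : ℕ) : ℝ) := Nat.cast_nonneg _
      refine (mul_le_mul_of_nonneg_left (OnlinePersuasion.benchmarkSuccess_le I hcmax) ?_).trans
        (OnlinePersuasion.le_growingPareto_success I (by omega) hle hcmax)
      exact div_nonneg (mul_nonneg hn' (by linarith)) (mul_nonneg (by linarith) (by linarith))
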